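/- Let $n\ge 0$ be an integer, and let $\mathscr{C}(\mathbb{R}^n)$ be the Chabauty space of $\mathbb{R}^n$, that is, the set of all closed subgroups of $(\mathbb{R}^n,+)$ with the topology in which the sets $$\mathcal{N}_U^K(\Gamma)=\{\Gamma'\in\mathscr{C}(\mathbb{R}^n) : \Gamma'\cap K\subset\Gamma+U \text{ and } \Gamma\cap K\subset\Gamma'+U\},$$ where $K$ runs over the compact subsets of $\mathbb{R}^n$ and $U$ over the neighbourhoods of $0$, form a basis of neighbourhoods of each point $\Gamma$. Then $\mathscr{C}(\mathbb{R}^n)$ is simply connected: it is nonempty and path-connected, and its fundamental group is trivial. -/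

import Mathlib

open scoped Pointwise Topology

/-- The set of closed subgroups of a topological group, written additively (the group need not be
commutative); it carries the topology `instTopologicalSpaceChabautySpace` below. -/
abbrev ChabautySpace (G : Type*) [AddGroup G] [TopologicalSpace G] : Type _ :=
  ClosedAddSubgroup G

namespace ChabautySpace

variable {G : Type*} [AddGroup G] [TopologicalSpace G]

/-- The basic neighbourhood of `Γ` given by `K` and `U`: the closed subgroups `Γ'` with
`Γ' ∩ K ⊆ Γ + U` and `Γ ∩ K ⊆ Γ' + U`. -/
def basicNhd (K U : Set G) (Γ : ChabautySpace G) : Set (ChabautySpace G) :=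
  {Γ' | (Γ' : Set G) ∩ K ⊆ (Γ : Set G) + U ∧ (Γ : Set G) ∩ K ⊆ (Γ' : Set G) + U}

theorem basicNhd_mono {K K' U U' : Set G} (hK : K ⊆ K') (hU : U' ⊆ U) (Γ : ChabautySpace G) :
    basicNhd K' U' Γ ⊆ basicNhd K U Γ := fun _ h =>
  ⟨((Set.inter_subset_inter_right _ hK).trans h.1).trans (Set.add_subset_add_left hU),
    ((Set.inter_subset_inter_right _ hK).trans h.2).trans (Set.add_subset_add_left hU)⟩

/-- The Chabauty topology: a set is open when with each of its points `Γ` it contains a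
`basicNhd K U Γ`, with `K` compact and `U` a neighbourhood of the neutral element. -/
instance instTopologicalSpaceChabautySpace : TopologicalSpace (ChabautySpace G) where
  IsOpen s := ∀ Γ ∈ s, ∃ K U : Set G, IsCompact K ∧ U ∈ 𝓝 (0 : G) ∧ basicNhd K U Γ ⊆ s
  isOpen_univ _ _ := ⟨∅, Set.univ, isCompact_empty, Filter.univ_mem, Set.subset_univ _⟩
  isOpen_inter s t hs ht Γ hΓ := by
    obtain ⟨K, U, hK, hU, h⟩ := hs Γ hΓ.1
    obtain ⟨K', U', hK', hU', h'⟩ := ht Γ hΓ.2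
    exact ⟨K ∪ K', U ∩ U', hK.union hK', Filter.inter_mem hU hU', Set.subset_inter
      ((basicNhd_mono Set.subset_union_left Set.inter_subset_left Γ).trans h)
      ((basicNhd_mono Set.subset_union_right Set.inter_subset_right Γ).trans h')⟩
  isOpen_sUnion S hS Γ := by
    rintro ⟨s, hs, hΓ⟩
    obtain ⟨K, U, hK, hU, h⟩ := hS s hs Γ hΓ
    exact ⟨K, U, hK, hU, h.trans (Set.subset_sUnion_of_mem hs)⟩

theorem isOpen_iff {s : Set (ChabautySpace G)} :
    IsOpen s ↔ ∀ Γ ∈ s, ∃ K U : Set G, IsCompact K ∧ U ∈ 𝓝 (0 : G) ∧ basicNhd K U Γ ⊆ s :=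
  Iff.rfl

theorem self_mem_basicNhd (K : Set G) {U : Set G} (hU : U ∈ 𝓝 (0 : G)) (Γ : ChabautySpace G) :
    Γ ∈ basicNhd K U Γ := by
  have h : (Γ : Set G) ∩ K ⊆ (Γ : Set G) + U := fun x hx =>
    ⟨x, hx.1, 0, mem_of_mem_nhds hU, add_zero x⟩
  exact ⟨h, h⟩

/-- In a locally compact group the sets `basicNhd K U Γ` are a basis of neighbourhoods of `Γ`. -/
theorem hasBasis_nhds [IsTopologicalAddGroup G] [LocallyCompactSpace G] (Γ : ChabautySpace G) :
    (𝓝 Γ).HasBasis (fun p : Set G × Set G => IsCompact p.1 ∧ p.2 ∈ 𝓝 (0 : G))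
      (fun p => basicNhd p.1 p.2 Γ) := by
  refine ⟨fun t => ⟨fun ht => ?_, ?_⟩⟩
  · obtain ⟨s, hst, hs, hΓ⟩ := mem_nhds_iff.1 ht
    obtain ⟨K, U, hK, hU, h⟩ := hs Γ hΓ
    exact ⟨(K, U), ⟨hK, hU⟩, h.trans hst⟩
  · rintro ⟨⟨K, U⟩, ⟨hK, hU⟩, h⟩
    have step : ∀ (K U : Set G), IsCompact K → U ∈ 𝓝 (0 : G) → ∃ K' V : Set G, IsCompact K' ∧
        V ∈ 𝓝 (0 : G) ∧ ∀ Γ₁ Γ₂ Γ₃ : ChabautySpace G, Γ₂ ∈ basicNhd K' V Γ₁ →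
          Γ₃ ∈ basicNhd K' V Γ₂ → Γ₃ ∈ basicNhd K U Γ₁ := by
      intro K U hK hU
      obtain ⟨W, hW, hWU⟩ := exists_nhds_zero_half hU
      obtain ⟨C, hC, hCW, hCc⟩ := local_compact_nhds hW
      have key : ∀ A B D : Set G, A ∩ (K + -C) ⊆ B + C → B ∩ (K + -C) ⊆ D + C →
          A ∩ K ⊆ D + U := by
        rintro A B D hAB hBD x ⟨hxA, hxK⟩
        obtain ⟨b, hb, c, hc, rfl⟩ := hAB
          ⟨hxA, ⟨x, hxK, 0, by simpa using mem_of_mem_nhds hC, add_zero x⟩⟩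
        obtain ⟨d, hd, c', hc', rfl⟩ := hBD
          ⟨hb, ⟨b + c, hxK, -c, by simpa using hc, by simp⟩⟩
        exact ⟨d, hd, c' + c, hWU _ (hCW hc') _ (hCW hc), by simp [add_assoc]⟩
      exact ⟨K + -C, C, hK.add hCc.neg, hC, fun Γ₁ Γ₂ Γ₃ h₁ h₂ =>
        ⟨key _ _ _ h₂.1 h₁.1, key _ _ _ h₁.2 h₂.2⟩⟩
    refine mem_nhds_iff.2 ⟨{Γ' | ∃ K' V : Set G, IsCompact K' ∧ V ∈ 𝓝 (0 : G) ∧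
      basicNhd K' V Γ' ⊆ basicNhd K U Γ}, ?_, ?_, ⟨K, U, hK, hU, subset_rfl⟩⟩
    · rintro Γ' ⟨K', V, -, hV, h'⟩
      exact h (h' (self_mem_basicNhd K' hV Γ'))
    · rintro Γ' ⟨K', V, hK', hV, h'⟩
      obtain ⟨K'', V', hK'', hV', h''⟩ := step K' V hK' hV
      exact ⟨K'', V', hK'', hV', fun Γ₂ hΓ₂ => ⟨K'', V', hK'', hV',
        fun Γ₃ hΓ₃ => h' (h'' Γ' Γ₂ Γ₃ hΓ₂ hΓ₃)⟩⟩

end ChabautySpace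

/-!
The discrete subgroups form a subset `D` which expansion `Γ ↦ t⁻¹ Γ`, `t → 0`, contracts to the
trivial subgroup. Two facts allow every path of closed subgroups to be pushed into `D`, up to its
end points, in a way that is unique up to homotopy.

* Every closed subgroup is, after a linear change of coordinates, a product `V × Λ` with `Λ`
  discrete, and is the limit of the discrete subgroups `s L × Λ`, where `L` is a lattice of `V`.
* Every closed subgroup has a neighbourhood `N` which contracts inside the whole space and whose
  trace on `D` is path connected. It suffices to know this near linear subspaces, because expansion
  brings `Γ` close to the largest linear subspace it contains. Near `V × 0` a subgroup becomes
  straight under a unique small shear: it then meets `{‖y‖ < 1}` in a `1`-dense subgroup of `V × 0`.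
  Contracting along `V` while expanding along `W` pushes straight subgroups to `V × 0`; expanding
  along `W` alone pushes the discrete ones to lattices of `V`, and these are joined by paths of
  bases, dilated so that they stay dense.
-/

open Filter Metric Set
open scoped unitInterval Pointwise Topology

section Limits

variable {X Z : Type*} [TopologicalSpace X] [TopologicalSpace Z]

theorem joinedIn_of_tendsto {S : Set X} {f : ℝ → X} {b : ℝ} (hb : 0 < b)
    (hf : ContinuousOn f (Ioc 0 b)) {x : X} (hx : Tendsto f (𝓝[>] 0) (𝓝 x)) (hxS : x ∈ S)
    (hfS : ∀ t ∈ Ioc 0 b, f t ∈ S) : JoinedIn S x (f b) := by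
  have hcont : ContinuousOn (Function.update f 0 x) (Icc 0 b) := by
    rw [continuousOn_update_iff, Icc_sdiff_left, nhdsWithin_Ioc_eq_nhdsGT hb]
    exact ⟨hf, fun _ => hx⟩
  have himage : Function.update f 0 x '' Icc 0 b ⊆ S := by
    rintro _ ⟨t, ht, rfl⟩
    rcases ht.1.eq_or_lt with rfl | h0
    · rwa [Function.update_self]
    · rw [Function.update_of_ne h0.ne']
      exact hfS t ⟨h0, ht.2⟩
  have hpath := ((convex_Icc 0 b).isPathConnected ⟨0, le_rfl, hb.le⟩).image' hcont
  have hjoin := hpath.joinedIn _ ⟨0, ⟨le_rfl, hb.le⟩, rfl⟩ _ ⟨b, ⟨hb.le, le_rfl⟩, rfl⟩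
  rw [Function.update_self, Function.update_of_ne hb.ne'] at hjoin
  exact hjoin.mono himage

theorem nullhomotopic_of_tendsto {F : ℝ × X → Z} (hF : ContinuousOn F (Ioi 0 ×ˢ univ)) {z : Z}
    (hz : ∀ x, Tendsto F (𝓝[>] 0 ×ˢ 𝓝 x) (𝓝 z)) (g : C(X, Z)) (hg : ∀ x, F (1, x) = g x) :
    g.Nullhomotopic := by
  classical
  let H : I × X → Z := fun q => if q.1 = 0 then z else F (q.1, q.2)
  have hcoe (q : I × X) : Tendsto (fun q : I × X => ((q.1 : ℝ), q.2)) (𝓝 q) (𝓝 (↑q.1, q.2)) :=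
    (by fun_prop : Continuous fun q : I × X => ((q.1 : ℝ), q.2)).continuousAt
  have hH : Continuous H := continuous_iff_continuousAt.2 fun ⟨t, x⟩ => by
    rcases eq_or_ne t 0 with rfl | ht
    · have hlim := hz x
      rw [← nhdsWithin_univ x, ← nhdsWithin_prod_eq] at hlim
      refine fun O hO => mem_map.2 ?_
      have hO' : O ∈ 𝓝 z := by simpa [H] using hO
      filter_upwards [hcoe (0, x) (mem_nhdsWithin_iff_eventually.1 (hlim hO'))] with q hq
      by_cases hq0 : q.1 = 0
      · simpa [H, hq0] using mem_of_mem_nhds hO'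
      · simpa [H, hq0] using hq ⟨unitInterval.pos_iff_ne_zero.2 hq0, trivial⟩
    · have ht' : (0 : ℝ) < t := unitInterval.pos_iff_ne_zero.2 ht
      have hFt : ContinuousAt F (t, x) :=
        hF.continuousAt ((isOpen_Ioi.prod isOpen_univ).mem_nhds ⟨ht', trivial⟩)
      refine (ContinuousAt.comp (f := fun q : I × X => ((q.1 : ℝ), q.2)) hFt
        (hcoe (t, x))).congr ?_
      filter_upwards [(isOpen_ne.preimage continuous_fst).mem_nhds (show (t, x).1 ≠ 0 from ht)]
        with q hq
      exact (if_neg hq).symm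
  exact ⟨z, ⟨ContinuousMap.Homotopy.symm
    { toFun := H
      continuous_toFun := hH
      map_zero_left := fun x => if_pos rfl
      map_one_left := fun x => (if_neg one_ne_zero).trans (hg x) }⟩⟩

end Limits

theorem path_trans_mem {X : Type*} [TopologicalSpace X] {S : Set X} {x y z : X} {p : Path x y}
    {q : Path y z} (hp : ∀ t, p t ∈ S) (hq : ∀ t, q t ∈ S) (t : I) : p.trans q t ∈ S := by
  rw [Path.trans_apply]
  split_ifs
  · exact hp _
  · exact hq _

/-- Two paths with the same endpoints that run in `N` are homotopic in the ambient space. The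
homotopy may leave `N`, so this is weaker than simple connectedness of the components of `N`. -/
def HomotopicallyTrivialIn {X : Type*} [TopologicalSpace X] (N : Set X) : Prop :=
  ∀ ⦃x y : X⦄ (p q : Path x y), (∀ t, p t ∈ N) → (∀ t, q t ∈ N) → p.Homotopic q

/-- `D` is locally accessible at `x`: arbitrarily small paths lead from `x` into `D`. -/
def AccessibleFrom {X : Type*} [TopologicalSpace X] (D : Set X) (x : X) : Prop :=
  ∀ O : Set X, IsOpen O → x ∈ O → ∃ y ∈ D, JoinedIn O x y

/-- The point `x` has a homotopically trivial neighbourhood whose trace on `D` is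
path connected. -/
def LocallyTrivialAt {X : Type*} [TopologicalSpace X] (D : Set X) (x : X) : Prop :=
  ∃ N ∈ 𝓝 x, HomotopicallyTrivialIn N ∧ IsPathConnected (N ∩ D)

open Path.Homotopic.Quotient in
/-- The class `α` of paths from `d` to `x` is represented by paths that run in `D` up to an
arbitrarily small last part. -/
def ApproachableIn {X : Type*} [TopologicalSpace X] (D : Set X) {d x : X}
    (α : Path.Homotopic.Quotient d x) : Prop :=
  ∀ O : Set X, IsOpen O → x ∈ O → ∃ (y : X) (a : Path d y) (c : Path y x),
    (∀ t, a t ∈ D) ∧ (∀ t, c t ∈ O) ∧ α = (mk a).trans (mk c)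

theorem LocallyTrivialAt.eventually {X : Type*} [TopologicalSpace X] {D : Set X} {x : X}
    (h : LocallyTrivialAt D x) : ∀ᶠ y in 𝓝 x, LocallyTrivialAt D y := by
  obtain ⟨N, hN, hNtriv⟩ := h
  exact (eventually_mem_nhds_iff.2 hN).mono fun y hy => ⟨N, hy, hNtriv⟩

section Transport

variable {X Y : Type*} [TopologicalSpace X] [TopologicalSpace Y] (φ : X ≃ₜ Y)

theorem HomotopicallyTrivialIn.preimage {N : Set Y} (h : HomotopicallyTrivialIn N) :
    HomotopicallyTrivialIn (φ ⁻¹' N) := by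
  intro x y p q hp hq
  have hmap := (h (p.map φ.continuous) (q.map φ.continuous) hp hq).map (φ.symm : C(Y, X))
  have hcast := hmap.pathCast (φ.symm_apply_apply x).symm (φ.symm_apply_apply y).symm
  convert! hcast using 1 <;> ext t <;> simp

theorem AccessibleFrom.preimage {D : Set Y} {x : X} (h : AccessibleFrom D (φ x)) :
    AccessibleFrom (φ ⁻¹' D) x := by
  intro O hO hx
  obtain ⟨y, hy, hj⟩ := h (φ.symm ⁻¹' O) (hO.preimage φ.symm.continuous) (by simpa using hx)
  refine ⟨φ.symm y, by simpa using hy, ?_⟩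
  simpa [φ.image_symm, ← preimage_comp] using hj.map φ.symm.continuous

theorem LocallyTrivialAt.preimage {D : Set Y} {x : X} (h : LocallyTrivialAt D (φ x)) :
    LocallyTrivialAt (φ ⁻¹' D) x := by
  obtain ⟨N, hN, htriv, hpath⟩ := h
  exact ⟨φ ⁻¹' N, φ.continuous.continuousAt hN, htriv.preimage φ,
    φ.isPathConnected_preimage.2 hpath⟩

end Transport

section Criterion

open Path.Homotopic.Quotient

variable {X : Type*} [TopologicalSpace X] {D N : Set X} {d x x' : X}

theorem HomotopicallyTrivialIn.of_nullhomotopic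
    (h : (⟨Subtype.val, continuous_subtype_val⟩ : C(N, X)).Nullhomotopic) :
    HomotopicallyTrivialIn N := by
  obtain ⟨c, ⟨F⟩⟩ := h
  intro x y p q hp hq
  have hx : x ∈ N := by simpa using hp 0
  have hy : y ∈ N := by simpa using hp 1
  let lift (r : Path x y) (hr : ∀ t, r t ∈ N) : Path (⟨x, hx⟩ : N) ⟨y, hy⟩ :=
    ⟨⟨fun t => ⟨r t, hr t⟩, by fun_prop⟩, by simp, by simp⟩
  have trans_evalAt (r : Path x y) (hr : ∀ t, r t ∈ N) :
      (mk r).trans (mk (F.evalAt ⟨y, hy⟩)) = (mk (F.evalAt ⟨x, hx⟩)).trans (refl c) := by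
    have hsquare := eq.2 (Path.Homotopic.map_trans_evalAt F (lift r hr))
    rw [mk_trans, mk_trans] at hsquare
    convert! hsquare using 1
  have hpq := congrArg (fun z => z.trans (symm (mk (F.evalAt ⟨y, hy⟩))))
    ((trans_evalAt p hp).trans (trans_evalAt q hq).symm)
  rw [← eq]
  simpa [trans_assoc] using hpq

theorem AccessibleFrom.of_tendsto {f : ℝ → X} (hf : ContinuousOn f (Ioi 0))
    (hx : Tendsto f (𝓝[>] 0) (𝓝 x)) (hD : ∀ t > 0, f t ∈ D) : AccessibleFrom D x := by
  intro O hO hxO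
  obtain ⟨b, hb, hbO⟩ := mem_nhdsGT_iff_exists_Ioc_subset.1 (hx (hO.mem_nhds hxO))
  exact ⟨f b, hD b hb, joinedIn_of_tendsto hb (hf.mono Ioc_subset_Ioi_self) hx hxO hbO⟩

namespace ApproachableIn

theorem unique (htriv : HomotopicallyTrivialIn D) (hloc : LocallyTrivialAt D x)
    {α β : Path.Homotopic.Quotient d x} (hα : ApproachableIn D α) (hβ : ApproachableIn D β) :
    α = β := by
  obtain ⟨N, hN, hNtriv, hNpath⟩ := hloc
  obtain ⟨O, hON, hO, hxO⟩ := mem_nhds_iff.1 hN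
  obtain ⟨y, a, c, ha, hc, rfl⟩ := hα O hO hxO
  obtain ⟨z, b, e, hb, he, rfl⟩ := hβ O hO hxO
  replace hc t := hON (hc t)
  replace he t := hON (he t)
  obtain ⟨f, hf⟩ := hNpath.joinedIn y ⟨by simpa using hc 0, by simpa using ha 1⟩
    z ⟨by simpa using he 0, by simpa using hb 1⟩
  have hcfe := eq.2 (hNtriv c (f.trans e) hc (path_trans_mem (fun t => (hf t).1) he))
  have hafb := eq.2 (htriv (a.trans f) b (path_trans_mem ha fun t => (hf t).2) hb)
  rw [mk_trans] at hcfe hafb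
  rw [hcfe, ← hafb, trans_assoc]

theorem trans_of_mem_interior (hacc : AccessibleFrom D x') (hNtriv : HomotopicallyTrivialIn N)
    (hNpath : IsPathConnected (N ∩ D)) {α : Path.Homotopic.Quotient d x}
    (hα : ApproachableIn D α) (p : Path x x') (hp : ∀ t, p t ∈ interior N) :
    ApproachableIn D (α.trans (mk p)) := by
  intro O hO hx'
  obtain ⟨z, hz, e, he⟩ := hacc (O ∩ interior N) (hO.inter isOpen_interior)
    ⟨hx', by simpa using hp 1⟩
  obtain ⟨y, a, c, ha, hc, rfl⟩ := hα (interior N) isOpen_interior (by simpa using hp 0)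
  replace hc t := interior_subset (hc t)
  replace hp t := interior_subset (hp t)
  have heN t : e.symm t ∈ N := interior_subset (he _).2
  obtain ⟨f, hf⟩ := hNpath.joinedIn y ⟨by simpa using hc 0, by simpa using ha 1⟩ z
    ⟨by simpa using heN 0, hz⟩
  refine ⟨z, a.trans f, e.symm, path_trans_mem ha fun t => (hf t).2, fun t => (he _).1, ?_⟩
  have hcp := eq.2 (hNtriv (c.trans p) (f.trans e.symm) (path_trans_mem hc hp)
    (path_trans_mem (fun t => (hf t).1) heN))
  rw [mk_trans, mk_trans] at hcp
  rw [trans_assoc, hcp, mk_trans, trans_assoc]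

theorem trans (hacc : ∀ x, AccessibleFrom D x) (hloc : ∀ x, LocallyTrivialAt D x)
    {α : Path.Homotopic.Quotient d x} (hα : ApproachableIn D α) (p : Path x x') :
    ApproachableIn D (α.trans (mk p)) := by
  choose N hN hNtriv hNpath using hloc
  obtain ⟨f, rfl, rfl⟩ := p
  set p : Path (f 0) (f 1) := ⟨f, rfl, rfl⟩
  obtain ⟨t, ht0, htm, ⟨m, hm⟩, hts⟩ := exists_monotone_Icc_subset_open_cover_unitInterval
    (c := fun y : X => f ⁻¹' interior (N y)) (fun y => isOpen_interior.preimage f.continuous)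
    (fun s _ => mem_iUnion.2 ⟨f s, mem_interior_iff_mem_nhds.2 (hN _)⟩)
  have hstep (n : ℕ) : ApproachableIn D (α.trans (mk (p.subpath 0 (t n)))) := by
    induction n with
    | zero =>
      rw [ht0, Path.subpath_self]
      exact (trans_refl α).symm ▸ hα
    | succ n ih =>
      obtain ⟨y, hy⟩ := hts n
      have hmem (s : I) : p.subpath (t n) (t (n + 1)) s ∈ interior (N y) := by
        have hrange := mem_range_self (f := p.subpath (t n) (t (n + 1))) s
        rw [Path.range_subpath_of_le _ _ _ (htm n.le_succ)] at hrange
        obtain ⟨u, hu, hus⟩ := hrange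
        exact hus ▸ hy hu
      have hnext := ih.trans_of_mem_interior (hacc _) (hNtriv y) (hNpath y) _ hmem
      rwa [trans_assoc, ← mk_trans, eq.2 ⟨Path.Homotopy.subpathTransSubpath p 0 _ _⟩] at hnext
  have hlast := hstep m
  rw [hm m le_rfl, Path.subpath_zero_one] at hlast
  exact hlast

end ApproachableIn

theorem simplyConnectedSpace_of_locallyTrivialAt (hD : IsPathConnected D)
    (htriv : HomotopicallyTrivialIn D) (hacc : ∀ x, AccessibleFrom D x)
    (hloc : ∀ x, LocallyTrivialAt D x) : SimplyConnectedSpace X := by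
  obtain ⟨d, hd, hDd⟩ := hD
  have hjoined (x : X) : Joined d x := by
    obtain ⟨y, hy, hxy⟩ := hacc x univ isOpen_univ trivial
    exact (hDd hy).joined.trans hxy.joined.symm
  have hpath : PathConnectedSpace X :=
    ⟨⟨d⟩, fun x y => (hjoined x).symm.trans (hjoined y)⟩
  refine simply_connected_iff_paths_homotopic'.2 ⟨hpath, fun {x y} p q => ?_⟩
  have hrefl : ApproachableIn D (refl d) := fun O _ hdO =>
    ⟨d, Path.refl d, Path.refl d, fun _ => hd, fun _ => hdO, by simp⟩
  have hγ := hrefl.trans hacc hloc (hjoined x).somePath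
  have hpq := (hγ.trans hacc hloc p).unique htriv (hloc y) (hγ.trans hacc hloc q)
  have hcancel :=
    congrArg (fun z => (symm ((refl d).trans (mk (hjoined x).somePath))).trans z) hpq
  rw [← eq]
  simpa only [← trans_assoc, symm_trans, refl_trans] using hcancel

end Criterion

namespace ChabautySpace

section Convergence

variable {G : Type*} [AddGroup G] [TopologicalSpace G]

theorem isClosed_coe (Γ : ChabautySpace G) : IsClosed (Γ : Set G) :=
  Γ.isClosed'

variable [IsTopologicalAddGroup G]

theorem isOpen_setOf_exists_mem {O : Set G} (hO : IsOpen O) :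
    IsOpen {Γ : ChabautySpace G | ∃ v ∈ O, v ∈ Γ} := by
  rintro Γ ⟨v, hvO, hv⟩
  refine ⟨{v}, {u | v - u ∈ O}, isCompact_singleton,
    (continuous_const.sub continuous_id).continuousAt.preimage_mem_nhds
      (hO.mem_nhds (by simpa using hvO)), fun Γ' hΓ' => ?_⟩
  obtain ⟨g, hg, u, hu, hgu : g + u = v⟩ := hΓ'.2 ⟨hv, rfl⟩
  exact ⟨v - u, hu, by rwa [← hgu, add_sub_cancel_right]⟩

theorem isOpen_setOf_forall_notMem {K : Set G} (hK : IsCompact K) :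
    IsOpen {Γ : ChabautySpace G | ∀ v ∈ K, v ∉ Γ} := by
  intro Γ hΓ
  obtain ⟨V, hV, hKV⟩ := compact_open_separated_add_right hK Γ.isClosed_coe.isOpen_compl hΓ
  refine ⟨K, -V, hK, neg_mem_nhds_zero G hV, fun Γ' hΓ' v hvK hv => ?_⟩
  obtain ⟨g, hg, u, hu, rfl⟩ := hΓ'.1 ⟨hv, hvK⟩
  exact hKV ⟨g + u, hvK, -u, hu, add_neg_cancel_right g u⟩ hg

variable {ι : Type*} {l : Filter ι} {f : ι → ChabautySpace G} {Γ : ChabautySpace G}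

theorem eventually_exists_mem_of_tendsto (hf : Tendsto f l (𝓝 Γ)) {v : G} (hv : v ∈ Γ)
    {O : Set G} (hO : O ∈ 𝓝 v) : ∀ᶠ i in l, ∃ u ∈ O, u ∈ f i := by
  obtain ⟨O', hO'O, hO', hvO'⟩ := mem_nhds_iff.1 hO
  filter_upwards [hf.eventually ((isOpen_setOf_exists_mem hO').mem_nhds ⟨v, hvO', hv⟩)]
  rintro i ⟨u, hu, hui⟩
  exact ⟨u, hO'O hu, hui⟩

theorem eventually_inter_subset_add {K U : Set G} (hK : IsCompact K) (hU : U ∈ 𝓝 (0 : G))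
    (hw : ∀ w ∉ Γ, ∀ᶠ p in l ×ˢ 𝓝 w, p.2 ∉ f p.1) :
    ∀ᶠ i in l, (f i : Set G) ∩ K ⊆ (Γ : Set G) + U := by
  have hdiff : IsCompact (K \ ((Γ : Set G) + interior U)) := hK.diff isOpen_interior.add_left
  have hsub : (Γ : Set G) ⊆ (Γ : Set G) + interior U := fun v hv =>
    ⟨v, hv, 0, mem_interior_iff_mem_nhds.2 hU, add_zero v⟩
  have hmiss := hdiff.mem_prod_nhdsSet_of_forall fun w hw' => hw w fun hwΓ => hw'.2 (hsub hwΓ)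
  filter_upwards [Eventually.curry hmiss] with i hi v hv
  by_contra hvU
  exact hi.self_of_nhdsSet v ⟨hv.2, fun hvU' =>
    hvU (add_subset_add_left interior_subset hvU')⟩ hv.1

theorem eventually_inter_subset_add_of_exists {K U : Set G} (hK : IsCompact K)
    (hU : U ∈ 𝓝 (0 : G)) (hv : ∀ v ∈ Γ, ∀ O ∈ 𝓝 v, ∀ᶠ i in l, ∃ u ∈ O, u ∈ f i) :
    ∀ᶠ i in l, (Γ : Set G) ∩ K ⊆ (f i : Set G) + U := by
  have hnear := (hK.inter_left Γ.isClosed_coe).mem_prod_nhdsSet_of_forall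
    (l := l) (s := {p | p.2 ∈ (f p.1 : Set G) + U}) fun v hvK => ?_
  · exact (Eventually.curry hnear).mono fun i hi => hi.self_of_nhdsSet
  have hsub : Tendsto (fun p : G × G => -p.1 + p.2) (𝓝 (v, v)) (𝓝 0) :=
    (continuous_fst.neg.add continuous_snd).tendsto' _ _ (neg_add_cancel v)
  rw [nhds_prod_eq] at hsub
  obtain ⟨O, hO, hOU⟩ := mem_prod_same_iff.1 (hsub hU)
  filter_upwards [(hv v hvK.1 O hO).prod_mk (show ∀ᶠ w in 𝓝 v, w ∈ O from hO)]
  rintro ⟨i, w⟩ ⟨⟨u, hu, hui⟩, hw⟩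
  exact ⟨u, hui, -u + w, hOU (mk_mem_prod hu hw), add_neg_cancel_left u w⟩

variable [LocallyCompactSpace G]

theorem eventually_notMem_of_tendsto (hf : Tendsto f l (𝓝 Γ)) {w : G} (hw : w ∉ Γ) :
    ∀ᶠ p in l ×ˢ 𝓝 w, p.2 ∉ f p.1 := by
  obtain ⟨K, hKw, hKΓ, hK⟩ := local_compact_nhds (Γ.isClosed_coe.isOpen_compl.mem_nhds hw)
  have hmiss := hf.eventually ((isOpen_setOf_forall_notMem hK).mem_nhds hKΓ)
  filter_upwards [hmiss.prod_mk (show ∀ᶠ u in 𝓝 w, u ∈ K from hKw)] with p hp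
  exact hp.1 _ hp.2

theorem tendsto_nhds_iff : Tendsto f l (𝓝 Γ) ↔
    (∀ v ∈ Γ, ∀ O ∈ 𝓝 v, ∀ᶠ i in l, ∃ u ∈ O, u ∈ f i) ∧
      ∀ w ∉ Γ, ∀ᶠ p in l ×ˢ 𝓝 w, p.2 ∉ f p.1 :=
  ⟨fun hf => ⟨fun _ hv _ hO => eventually_exists_mem_of_tendsto hf hv hO,
    fun _ hw => eventually_notMem_of_tendsto hf hw⟩,
  fun ⟨hv, hw⟩ => (hasBasis_nhds Γ).tendsto_right_iff.2 fun _ hKU =>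
    (eventually_inter_subset_add hKU.1 hKU.2 hw).and
      (eventually_inter_subset_add_of_exists hKU.1 hKU.2 hv)⟩

theorem tendsto_of_eventually_mem (hv : ∀ v ∈ Γ, ∀ O ∈ 𝓝 v, ∀ᶠ i in l, ∃ u ∈ O, u ∈ f i)
    (hw : ∀ w, ∀ᶠ p in l ×ˢ 𝓝 w, p.2 ∈ f p.1 → p.2 ∈ Γ) : Tendsto f l (𝓝 Γ) := by
  refine tendsto_nhds_iff.2 ⟨hv, fun w hwΓ => ?_⟩
  filter_upwards [hw w, tendsto_snd.eventually
    (Γ.isClosed_coe.isOpen_compl.eventually_mem hwΓ)] with p hp hpΓ hmem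
  exact hpΓ (hp hmem)

end Convergence

section Constructions

variable {G H : Type*} [AddGroup G] [TopologicalSpace G] [AddGroup H] [TopologicalSpace H]

/-- The preimage of a closed subgroup under a continuous homomorphism. -/
def comap {F : Type*} [FunLike F G H] [AddMonoidHomClass F G H] [ContinuousMapClass F G H]
    (A : F) (Γ : ChabautySpace H) : ChabautySpace G where
  toAddSubgroup := Γ.toAddSubgroup.comap (A : G →+ H)
  isClosed' := Γ.isClosed'.preimage (map_continuous A)

/-- The product of two closed subgroups. -/
def prod (Γ : ChabautySpace G) (Λ : ChabautySpace H) : ChabautySpace (G × H) where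
  toAddSubgroup := Γ.toAddSubgroup.prod Λ.toAddSubgroup
  isClosed' := Γ.isClosed'.prod Λ.isClosed'

/-- The trivial subgroup as a point of the Chabauty space. -/
def trivialSubgroup (G : Type*) [AddGroup G] [TopologicalSpace G] [T1Space G] :
    ChabautySpace G where
  toAddSubgroup := ⊥
  isClosed' := isClosed_singleton

/-- The whole group as a point of the Chabauty space. -/
def wholeGroup (G : Type*) [AddGroup G] [TopologicalSpace G] : ChabautySpace G where
  toAddSubgroup := ⊤
  isClosed' := isClosed_univ

section Mem

variable {F : Type*} [FunLike F G H] [AddMonoidHomClass F G H] [ContinuousMapClass F G H]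

@[simp]
theorem mem_comap {A : F} {Γ : ChabautySpace H} {v : G} : v ∈ comap A Γ ↔ A v ∈ Γ :=
  Iff.rfl

@[simp]
theorem mem_prod {Γ : ChabautySpace G} {Λ : ChabautySpace H} {v : G × H} :
    v ∈ prod Γ Λ ↔ v.1 ∈ Γ ∧ v.2 ∈ Λ :=
  Iff.rfl

@[simp]
theorem mem_trivialSubgroup [T1Space G] {v : G} : v ∈ trivialSubgroup G ↔ v = 0 :=
  Iff.rfl

@[simp]
theorem mem_wholeGroup (v : G) : v ∈ wholeGroup G :=
  trivial

end Mem

variable [IsTopologicalAddGroup G] [LocallyCompactSpace G]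
  [IsTopologicalAddGroup H] [LocallyCompactSpace H] {ι Y : Type*} [TopologicalSpace Y]
  {l : Filter ι} {F : Type*} [FunLike F G H] [AddMonoidHomClass F G H] [ContinuousMapClass F G H]

theorem tendsto_comap {f : ι → ChabautySpace H} {Γ : ChabautySpace H} {A : ι → F} {A₀ : F}
    {B : ι → H → G} (hf : Tendsto f l (𝓝 Γ))
    (hA : ∀ v, Tendsto (fun p : ι × G => A p.1 p.2) (l ×ˢ 𝓝 v) (𝓝 (A₀ v)))
    (hB : ∀ v, Tendsto (fun p : ι × H => B p.1 p.2) (l ×ˢ 𝓝 (A₀ v)) (𝓝 v))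
    (hAB : ∀ᶠ i in l, Function.RightInverse (B i) (A i)) :
    Tendsto (fun i => comap (A i) (f i)) l (𝓝 (comap A₀ Γ)) := by
  rw [tendsto_nhds_iff] at hf ⊢
  refine ⟨fun v hv O hO => ?_, fun w hw => ?_⟩
  · obtain ⟨S, hS, O', hO', hSO⟩ := mem_prod_iff.1 (hB v hO)
    filter_upwards [hS, hAB, hf.1 _ hv O' hO']
    rintro i hi hABi ⟨u, hu, hui⟩
    exact ⟨B i u, hSO (mk_mem_prod hi hu), by rwa [mem_comap, hABi]⟩
  · exact (tendsto_fst.prodMk (hA w)).eventually (hf.2 _ hw)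

theorem continuousOn_comap {s : Set Y} {f : Y → ChabautySpace H} {A : Y → F} {B : Y → H → G}
    (hf : ContinuousOn f s) (hA : ContinuousOn (fun p : Y × G => A p.1 p.2) (s ×ˢ univ))
    (hB : ContinuousOn (fun p : Y × H => B p.1 p.2) (s ×ˢ univ))
    (hBA : ∀ y ∈ s, Function.LeftInverse (B y) (A y))
    (hAB : ∀ y ∈ s, Function.RightInverse (B y) (A y)) :
    ContinuousOn (fun y => comap (A y) (f y)) s := by
  intro y hy
  refine tendsto_comap (B := B) (hf y hy) (fun v => ?_) (fun v => ?_)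
    (eventually_mem_nhdsWithin.mono hAB)
  · have hAv := hA (y, v) ⟨hy, trivial⟩
    rwa [ContinuousWithinAt, nhdsWithin_prod_eq, nhdsWithin_univ] at hAv
  · have hBv := hB (y, A y v) ⟨hy, trivial⟩
    rwa [ContinuousWithinAt, nhdsWithin_prod_eq, nhdsWithin_univ, hBA y hy] at hBv

theorem tendsto_prod {f : ι → ChabautySpace G} {g : ι → ChabautySpace H} {Γ : ChabautySpace G}
    {Λ : ChabautySpace H} (hf : Tendsto f l (𝓝 Γ)) (hg : Tendsto g l (𝓝 Λ)) :
    Tendsto (fun i => prod (f i) (g i)) l (𝓝 (prod Γ Λ)) := by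
  rw [tendsto_nhds_iff] at hf hg ⊢
  refine ⟨fun v hv O hO => ?_, fun w hw => ?_⟩
  · obtain ⟨P, hP, Q, hQ, hPQ⟩ := mem_nhds_prod_iff.1 hO
    filter_upwards [hf.1 _ hv.1 P hP, hg.1 _ hv.2 Q hQ]
    rintro i ⟨u, hu, hui⟩ ⟨u', hu', hui'⟩
    exact ⟨(u, u'), hPQ ⟨hu, hu'⟩, hui, hui'⟩
  · rw [mem_prod, not_and_or] at hw
    rcases hw with hw | hw
    · exact ((tendsto_id.prodMap (continuous_fst.tendsto w)).eventually
        (hf.2 _ hw)).mono fun p hp hmem => hp hmem.1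
    · exact ((tendsto_id.prodMap (continuous_snd.tendsto w)).eventually
        (hg.2 _ hw)).mono fun p hp hmem => hp hmem.2

/-- The homeomorphism of Chabauty spaces induced by an isomorphism of topological groups. -/
def congr (e : G ≃ₜ+ H) : ChabautySpace G ≃ₜ ChabautySpace H where
  toFun := comap e.symm
  invFun := comap e
  left_inv Γ := SetLike.ext fun v => by simp
  right_inv Γ := SetLike.ext fun v => by simp
  continuous_toFun := continuousOn_univ.1 <| continuousOn_comap (A := fun _ => e.symm)
    (B := fun _ => e) continuousOn_id (by fun_prop) (by fun_prop)
    (fun _ _ => e.apply_symm_apply) (fun _ _ => e.symm_apply_apply)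
  continuous_invFun := continuousOn_univ.1 <| continuousOn_comap (A := fun _ => e)
    (B := fun _ => e.symm) continuousOn_id (by fun_prop) (by fun_prop)
    (fun _ _ => e.symm_apply_apply) (fun _ _ => e.apply_symm_apply)

end Constructions

section Discrete

variable {G H : Type*} [AddGroup G] [TopologicalSpace G] [AddGroup H] [TopologicalSpace H]

/-- The set of discrete subgroups, as a subset of the Chabauty space. -/
def discreteSubgroups (G : Type*) [AddGroup G] [TopologicalSpace G] : Set (ChabautySpace G) :=
  {Γ | DiscreteTopology Γ}

theorem trivialSubgroup_mem_discreteSubgroups [T1Space G] :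
    trivialSubgroup G ∈ discreteSubgroups G :=
  show DiscreteTopology (⊥ : AddSubgroup G) from inferInstance

theorem mem_discreteSubgroups_iff [IsTopologicalAddGroup G] {Γ : ChabautySpace G} :
    Γ ∈ discreteSubgroups G ↔ ∀ᶠ v in 𝓝 0, v ∈ Γ → v = 0 := by
  change DiscreteTopology Γ.toAddSubgroup ↔ _
  have hnhds : IsOpen ({0} : Set Γ.toAddSubgroup) ↔ {0} ∈ 𝓝 (0 : Γ.toAddSubgroup) := by
    simp [isOpen_iff_mem_nhds]
  rw [discreteTopology_iff_isOpen_singleton_zero, hnhds, nhds_subtype_eq_comap, mem_comap']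
  refine eventually_congr (.of_forall fun v => ⟨fun h hv => ?_, fun h w hw => ?_⟩)
  · exact congrArg Subtype.val (h (x := ⟨v, hv⟩) rfl)
  · exact Subtype.ext (hw.trans (h (hw ▸ w.2)))

variable [IsTopologicalAddGroup G] [IsTopologicalAddGroup H]

theorem comap_mem_discreteSubgroups {F : Type*} [FunLike F G H] [AddMonoidHomClass F G H]
    [ContinuousMapClass F G H] {A : F} (hA : Function.Injective A) {Γ : ChabautySpace H}
    (hΓ : Γ ∈ discreteSubgroups H) : comap A Γ ∈ discreteSubgroups G := by
  rw [mem_discreteSubgroups_iff] at hΓ ⊢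
  filter_upwards [((map_continuous A).tendsto' 0 0 (map_zero A)).eventually hΓ] with v hv hmem
  exact hA ((hv hmem).trans (map_zero A).symm)

theorem prod_mem_discreteSubgroups {Γ : ChabautySpace G} {Λ : ChabautySpace H}
    (hΓ : Γ ∈ discreteSubgroups G) (hΛ : Λ ∈ discreteSubgroups H) :
    prod Γ Λ ∈ discreteSubgroups (G × H) := by
  rw [mem_discreteSubgroups_iff] at hΓ hΛ ⊢
  filter_upwards [hΓ.prod_nhds hΛ] with v hv hmem
  exact Prod.ext (hv.1 hmem.1) (hv.2 hmem.2)

theorem preimage_congr_discreteSubgroups [LocallyCompactSpace G] [LocallyCompactSpace H]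
    (e : G ≃ₜ+ H) : congr e ⁻¹' discreteSubgroups H = discreteSubgroups G := by
  ext Γ
  refine ⟨fun hΓ => ?_, fun hΓ => comap_mem_discreteSubgroups e.symm.injective hΓ⟩
  rw [← (congr e).symm_apply_apply Γ]
  exact comap_mem_discreteSubgroups e.injective hΓ

end Discrete

section Dilation

variable {E : Type*} [NormedAddCommGroup E] [NormedSpace ℝ E]

/-- The dilate `t⁻¹ Γ`, taken as the preimage of `Γ` under multiplication by `t`; for `t = 0` this
is the whole space. -/
def dilate (t : ℝ) (Γ : ChabautySpace E) : ChabautySpace E :=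
  comap (t • ContinuousLinearMap.id ℝ E) Γ

@[simp]
theorem mem_dilate {t : ℝ} {Γ : ChabautySpace E} {v : E} : v ∈ dilate t Γ ↔ t • v ∈ Γ :=
  Iff.rfl

@[simp]
theorem dilate_one (Γ : ChabautySpace E) : dilate 1 Γ = Γ :=
  SetLike.ext fun v => by simp

theorem dilate_dilate (s t : ℝ) (Γ : ChabautySpace E) : dilate s (dilate t Γ) = dilate (t * s) Γ :=
  SetLike.ext fun v => by simp [mul_smul]

theorem dilate_mem_discreteSubgroups {t : ℝ} (ht : t ≠ 0) {Γ : ChabautySpace E}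
    (hΓ : Γ ∈ discreteSubgroups E) : dilate t Γ ∈ discreteSubgroups E :=
  comap_mem_discreteSubgroups (smul_right_injective E ht) hΓ

theorem exists_nsmul_norm_mem_Icc {v : E} {r : ℝ} (hv : v ≠ 0) (hr : ‖v‖ ≤ r) :
    ∃ k : ℕ, ‖k • v‖ ∈ Icc (r / 2) r := by
  have hpos : 0 < ‖v‖ := norm_pos_iff.2 hv
  refine ⟨⌊r / ‖v‖⌋₊, ?_⟩
  rw [← Nat.cast_smul_eq_nsmul ℝ, norm_smul, Real.norm_natCast]
  have hle := Nat.floor_le (div_nonneg (hpos.le.trans hr) hpos.le)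
  have hlt := Nat.lt_floor_add_one (r / ‖v‖)
  have hone : (1 : ℝ) ≤ ⌊r / ‖v‖⌋₊ := by
    exact_mod_cast Nat.le_floor (by rw [Nat.cast_one, one_le_div hpos]; exact hr)
  rw [le_div_iff₀ hpos] at hle
  rw [div_lt_iff₀ hpos] at hlt
  exact ⟨by nlinarith, hle⟩

variable [ProperSpace E]

theorem continuousOn_dilate :
    ContinuousOn (fun p : ℝ × ChabautySpace E => dilate p.1 p.2) ({0}ᶜ ×ˢ univ) := by
  refine continuousOn_comap (f := Prod.snd) (A := fun p => p.1 • ContinuousLinearMap.id ℝ E)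
    (B := fun p v => p.1⁻¹ • v) continuousOn_snd ?_ ?_ ?_ ?_
  · simp only [smul_apply, ContinuousLinearMap.id_apply]
    fun_prop
  · exact ContinuousOn.smul (ContinuousOn.inv₀ (by fun_prop) fun p hp => hp.1.1) (by fun_prop)
  · exact fun p hp v => inv_smul_smul₀ (mem_compl_singleton_iff.1 hp.1) v
  · exact fun p hp v => smul_inv_smul₀ (mem_compl_singleton_iff.1 hp.1) v

/-- The radius of isolation of `0` is locally bounded below: a small nonzero vector of a group
near `Γ` would have a multiple in a fixed compact annulus which `Γ` misses. -/
theorem eventually_eq_zero_of_mem {Γ : ChabautySpace E} (hΓ : Γ ∈ discreteSubgroups E) :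
    ∀ᶠ p in 𝓝 Γ ×ˢ 𝓝 (0 : E), p.2 ∈ p.1 → p.2 = 0 := by
  obtain ⟨r, hr, hrΓ⟩ := Metric.eventually_nhds_iff_ball.1 (mem_discreteSubgroups_iff.1 hΓ)
  have hK : IsCompact (closedBall (0 : E) (r / 2) \ ball 0 (r / 4)) :=
    (isCompact_closedBall _ _).diff isOpen_ball
  have hmiss : ∀ v ∈ closedBall (0 : E) (r / 2) \ ball 0 (r / 4), v ∉ Γ := by
    rintro v ⟨hv, hv'⟩ hvΓ
    rw [hrΓ v (closedBall_subset_ball (half_lt_self hr) hv) hvΓ] at hv'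
    exact hv' (mem_ball_self (by positivity))
  filter_upwards [((isOpen_setOf_forall_notMem hK).eventually_mem hmiss).prod_mk
    (eventually_mem_set.2 (ball_mem_nhds (0 : E) (half_pos hr)))]
  rintro ⟨Γ', v⟩ ⟨hΓ', hvr⟩ hv
  by_contra hv0
  obtain ⟨k, hk, hk'⟩ := exists_nsmul_norm_mem_Icc hv0 (mem_ball_zero_iff.1 hvr).le
  refine hΓ' (k • v) ⟨mem_closedBall_zero_iff.2 hk', ?_⟩ (nsmul_mem hv k)
  rw [mem_ball_zero_iff, not_lt]
  linarith

theorem tendsto_dilate_trivialSubgroup {ι : Type*} {l : Filter ι} {t : ι → ℝ}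
    {f : ι → ChabautySpace E} {Γ : ChabautySpace E} (ht : Tendsto t l (𝓝[≠] 0))
    (hf : Tendsto f l (𝓝 Γ)) (hΓ : Γ ∈ discreteSubgroups E) :
    Tendsto (fun i => dilate (t i) (f i)) l (𝓝 (trivialSubgroup E)) := by
  obtain ⟨ht, ht0⟩ := tendsto_nhdsWithin_iff.1 ht
  refine tendsto_of_eventually_mem (fun v hv O hO => ?_) fun w => ?_
  · rw [mem_trivialSubgroup] at hv
    exact .of_forall fun i => ⟨0, mem_of_mem_nhds (hv ▸ hO), zero_mem _⟩
  · have hsmul : Tendsto (fun p : ι × E => t p.1 • p.2) (l ×ˢ 𝓝 w) (𝓝 0) := by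
      simpa using (ht.comp tendsto_fst).smul (tendsto_snd (g := 𝓝 w))
    filter_upwards [((hf.comp tendsto_fst).prodMk hsmul).eventually (eventually_eq_zero_of_mem hΓ),
      tendsto_fst.eventually ht0] with p hp hp0 hmem
    exact (smul_eq_zero.1 (hp hmem)).resolve_left hp0

theorem homotopicallyTrivialIn_discreteSubgroups :
    HomotopicallyTrivialIn (discreteSubgroups E) := by
  refine .of_nullhomotopic <| nullhomotopic_of_tendsto
    (F := fun p : ℝ × discreteSubgroups E => dilate p.1 (p.2 : ChabautySpace E))
    (z := trivialSubgroup E) ?_ (fun Γ => ?_) _ fun Γ => dilate_one _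
  · exact continuousOn_dilate.comp (t := {0}ᶜ ×ˢ univ)
      (f := Prod.map id (Subtype.val : discreteSubgroups E → ChabautySpace E))
      (by fun_prop) fun p hp => ⟨ne_of_gt hp.1, trivial⟩
  · exact tendsto_dilate_trivialSubgroup (tendsto_fst.mono_right (nhdsGT_le_nhdsNE 0))
      ((continuous_subtype_val.tendsto Γ).comp tendsto_snd) Γ.2

theorem isPathConnected_discreteSubgroups : IsPathConnected (discreteSubgroups E) := by
  refine ⟨_, trivialSubgroup_mem_discreteSubgroups, fun {Γ} hΓ => ?_⟩
  rw [← dilate_one Γ]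
  refine joinedIn_of_tendsto (f := fun t => dilate t Γ) one_pos ?_
    (tendsto_dilate_trivialSubgroup (nhdsGT_le_nhdsNE 0) tendsto_const_nhds hΓ)
    trivialSubgroup_mem_discreteSubgroups fun t ht => dilate_mem_discreteSubgroups ht.1.ne' hΓ
  exact continuousOn_dilate.comp (f := fun t : ℝ => (t, Γ)) (by fun_prop)
    fun t ht => ⟨ht.1.ne', trivial⟩

end Dilation

section Dense

variable {V : Type*} [NormedAddCommGroup V]

/-- The set of `1`-dense closed subgroups: every point is at distance at most `1` from them. -/
def denseSubgroups (V : Type*) [NormedAddCommGroup V] : Set (ChabautySpace V) :=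
  {Γ | ∀ x, ∃ y ∈ Γ, ‖y - x‖ ≤ 1}

variable [NormedSpace ℝ V]

theorem dilate_mem_denseSubgroups_iff {Γ : ChabautySpace V} {t : ℝ} (ht : t ≠ 0) :
    dilate t Γ ∈ denseSubgroups V ↔ ∀ x, ∃ y ∈ Γ, ‖y - x‖ ≤ |t| := by
  have hnorm (x y : V) : ‖t • y - t • x‖ = |t| * ‖y - x‖ := by
    rw [← smul_sub, norm_smul, Real.norm_eq_abs]
  have htpos : 0 < |t| := abs_pos.2 ht
  constructor
  · intro h x
    obtain ⟨y, hy, hyx⟩ := h (t⁻¹ • x)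
    refine ⟨t • y, hy, ?_⟩
    rw [← smul_inv_smul₀ ht x, hnorm]
    exact mul_le_of_le_one_right htpos.le hyx
  · intro h x
    obtain ⟨y, hy, hyx⟩ := h (t • x)
    rw [← smul_inv_smul₀ ht y, hnorm] at hyx
    exact ⟨t⁻¹ • y, by simpa [ht] using hy, by nlinarith⟩

theorem dilate_mem_denseSubgroups {Γ : ChabautySpace V} (hΓ : Γ ∈ denseSubgroups V) {t : ℝ}
    (ht : 1 ≤ t) : dilate t Γ ∈ denseSubgroups V :=
  (dilate_mem_denseSubgroups_iff (by positivity)).2 fun x =>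
    (hΓ x).imp fun _ hy => ⟨hy.1, hy.2.trans (ht.trans (le_abs_self t))⟩

variable [ProperSpace V]

theorem tendsto_dilate_inv_wholeGroup {ι : Type*} {l : Filter ι} {t : ι → ℝ}
    {f : ι → ChabautySpace V} (ht : Tendsto t l (𝓝[≠] 0))
    (hf : ∀ᶠ i in l, f i ∈ denseSubgroups V) :
    Tendsto (fun i => dilate (t i)⁻¹ (f i)) l (𝓝 (wholeGroup V)) := by
  obtain ⟨ht, ht0⟩ := tendsto_nhdsWithin_iff.1 ht
  refine tendsto_of_eventually_mem (fun v _ O hO => ?_) fun w => .of_forall fun p _ =>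
    mem_wholeGroup p.2
  obtain ⟨ε, hε, hεO⟩ := Metric.mem_nhds_iff.1 hO
  filter_upwards [hf, ht0, Metric.tendsto_nhds.1 ht ε hε] with i hi hi0 hiε
  have hdense : dilate (t i) (dilate (t i)⁻¹ (f i)) ∈ denseSubgroups V := by
    rwa [dilate_dilate, inv_mul_cancel₀ hi0, dilate_one]
  obtain ⟨u, hu, huv⟩ := (dilate_mem_denseSubgroups_iff hi0).1 hdense v
  refine ⟨u, hεO ?_, hu⟩
  rw [mem_ball, dist_eq_norm]
  exact huv.trans_lt (by rwa [Real.dist_0_eq_abs] at hiε)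

end Dense

section NearAxis

variable {V W : Type*} [NormedAddCommGroup V] [NormedAddCommGroup W]

/-- The subgroup `V × 0` of `V × W`. -/
def axis (V W : Type*) [NormedAddCommGroup V] [NormedAddCommGroup W] : ChabautySpace (V × W) :=
  prod (wholeGroup V) (trivialSubgroup W)

@[simp]
theorem mem_axis {v : V × W} : v ∈ axis V W ↔ v.2 = 0 := by
  simp [axis]

variable [NormedSpace ℝ V] [NormedSpace ℝ W]

/-- The trace on `V × 0` of a closed subgroup of `V × W`, as a subgroup of `V`. -/
def trace (Γ : ChabautySpace (V × W)) : ChabautySpace V :=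
  comap (ContinuousLinearMap.inl ℝ V W) Γ

@[simp]
theorem mem_trace {Γ : ChabautySpace (V × W)} {x : V} : x ∈ trace Γ ↔ (x, (0 : W)) ∈ Γ :=
  Iff.rfl

/-- The straight subgroups of `V × W`: their elements at distance less than `1` from `V × 0` lie
in `V × 0` and are `1`-dense there. -/
def straightSubgroups (V W : Type*) [NormedAddCommGroup V] [NormedSpace ℝ V]
    [NormedAddCommGroup W] [NormedSpace ℝ W] : Set (ChabautySpace (V × W)) :=
  {Γ | (∀ v ∈ Γ, ‖v.2‖ < 1 → v.2 = 0) ∧ trace Γ ∈ denseSubgroups V}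

/-- The shear `(x, y) ↦ (x, y + τ x)` of `V × W`. -/
def shear (τ : V →L[ℝ] W) : V × W →L[ℝ] V × W :=
  .id ℝ (V × W) + (ContinuousLinearMap.inr ℝ V W).comp (τ.comp (.fst ℝ V W))

/-- The linear map of `V × W` that is the scalar `a` on `V` and the scalar `b` on `W`. -/
def stretch (a b : ℝ) : V × W →L[ℝ] V × W :=
  (a • .id ℝ V : V →L[ℝ] V).prodMap (b • .id ℝ W : W →L[ℝ] W)

/-- The closed subgroups of `V × W` that become straight under a small shear. They form a
neighbourhood of `V × 0`; the bound on the shear makes it unique. -/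
def nearAxis (V W : Type*) [NormedAddCommGroup V] [NormedSpace ℝ V] [NormedAddCommGroup W]
    [NormedSpace ℝ W] : Set (ChabautySpace (V × W)) :=
  {Γ | ∃ τ : V →L[ℝ] W, ‖τ‖ ≤ 1 / 8 ∧ comap (shear τ) Γ ∈ straightSubgroups V W}

@[simp]
theorem shear_apply (τ : V →L[ℝ] W) (v : V × W) : shear τ v = (v.1, v.2 + τ v.1) := by
  ext <;> simp [shear]

@[simp]
theorem stretch_apply (a b : ℝ) (v : V × W) : stretch a b v = (a • v.1, b • v.2) := rfl

theorem shear_injective (τ : V →L[ℝ] W) : Function.Injective (shear τ) :=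
  Function.LeftInverse.injective (g := shear (-τ)) fun v => by simp

theorem stretch_injective {a b : ℝ} (ha : a ≠ 0) (hb : b ≠ 0) :
    Function.Injective (stretch a b : V × W →L[ℝ] V × W) :=
  Function.LeftInverse.injective (g := stretch a⁻¹ b⁻¹) fun v => by simp [ha, hb]

@[simp]
theorem comap_shear_zero (Γ : ChabautySpace (V × W)) : comap (shear (0 : V →L[ℝ] W)) Γ = Γ :=
  SetLike.ext fun v => by simp

theorem straightSubgroups_subset_nearAxis : straightSubgroups V W ⊆ nearAxis V W :=
  fun Γ hΓ => ⟨0, by simp, by rwa [comap_shear_zero]⟩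

theorem eq_of_comap_shear_mem_straightSubgroups {Γ : ChabautySpace (V × W)} {τ τ' : V →L[ℝ] W}
    (hτ : ‖τ‖ ≤ 1 / 8) (hτ' : ‖τ'‖ ≤ 1 / 8) (hΓ : comap (shear τ) Γ ∈ straightSubgroups V W)
    (hΓ' : comap (shear τ') Γ ∈ straightSubgroups V W) : τ = τ' := by
  set ρ := τ - τ' with hρ
  have hρnorm : ‖ρ‖ ≤ 1 / 4 := (norm_sub_le _ _).trans (by linarith)
  refine sub_eq_zero.1 (ContinuousLinearMap.ext fun u => by_contra fun hu => ?_)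
  have hupos : 0 < ‖ρ u‖ := norm_pos_iff.2 hu
  let y : V := (1 / 2 / ‖ρ u‖) • u
  have hy : ‖ρ y‖ = 1 / 2 := by
    rw [map_smul, norm_smul, Real.norm_of_nonneg (by positivity), div_mul_cancel₀ _ hupos.ne']
  obtain ⟨x, hx, hxy⟩ := hΓ.2 y
  have hρxy : ‖ρ x - ρ y‖ ≤ 1 / 4 := by
    rw [← map_sub]
    exact (ρ.le_opNorm _).trans (mul_le_of_le_one_right (norm_nonneg ρ) hxy |>.trans hρnorm)
  have hmem : (x, ρ x) ∈ comap (shear τ') Γ := by simpa [hρ] using hx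
  have hρx : ρ x = 0 := hΓ'.1 _ hmem <| by
    have := norm_le_norm_add_norm_sub' (ρ x) (ρ y)
    change ‖ρ x‖ < 1
    linarith
  rw [hρx, zero_sub, norm_neg, hy] at hρxy
  norm_num at hρxy

theorem isClosed_straightSubgroups [ProperSpace V] : IsClosed (straightSubgroups V W) := by
  have hgap : IsOpen {Γ : ChabautySpace (V × W) |
      ∃ v ∈ {v : V × W | ‖v.2‖ < 1 ∧ v.2 ≠ 0}, v ∈ Γ} :=
    isOpen_setOf_exists_mem <| .inter
      (isOpen_lt (f := fun v : V × W => ‖v.2‖) (by fun_prop) continuous_const)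
      (isOpen_ne_fun continuous_snd continuous_const)
  have hdense (x : V) : IsOpen {Γ : ChabautySpace (V × W) |
      ∀ v ∈ closedBall x 1 ×ˢ ({0} : Set W), v ∉ Γ} :=
    isOpen_setOf_forall_notMem ((isCompact_closedBall _ _).prod isCompact_singleton)
  convert! hgap.isClosed_compl.inter (isClosed_iInter fun x => (hdense x).isClosed_compl) using 1
  ext Γ
  simp only [straightSubgroups, denseSubgroups, mem_ofPred_eq, mem_inter_iff, mem_compl_iff,
    mem_iInter, Set.mem_prod, mem_closedBall, dist_eq_norm, mem_singleton_iff]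
  refine and_congr (by grind) (forall_congr' fun x => ?_)
  push Not
  exact ⟨fun ⟨y, hy, hyx⟩ => ⟨(y, 0), ⟨hyx, rfl⟩, hy⟩,
    fun ⟨v, ⟨hvx, hv⟩, hvΓ⟩ => ⟨v.1, show (v.1, (0 : W)) ∈ Γ from hv ▸ hvΓ, hvx⟩⟩

variable [ProperSpace V] [ProperSpace W] {Y : Type*} [TopologicalSpace Y]

theorem continuousOn_comap_stretch {s : Set Y} {f : Y → ChabautySpace (V × W)} {a b : Y → ℝ}
    (hf : ContinuousOn f s) (ha : ContinuousOn a s) (hb : ContinuousOn b s)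
    (ha0 : ∀ y ∈ s, a y ≠ 0) (hb0 : ∀ y ∈ s, b y ≠ 0) :
    ContinuousOn (fun y => comap (stretch (a y) (b y)) (f y)) s := by
  have hfst : MapsTo Prod.fst (s ×ˢ (univ : Set (V × W))) s := fun p hp => hp.1
  have hcont {a b : Y → ℝ} (ha : ContinuousOn a s) (hb : ContinuousOn b s) :
      ContinuousOn (fun p : Y × (V × W) => stretch (a p.1) (b p.1) p.2) (s ×ˢ univ) :=
    ((ha.comp continuousOn_fst hfst).smul continuous_snd.fst.continuousOn).prodMk
      ((hb.comp continuousOn_fst hfst).smul continuous_snd.snd.continuousOn)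
  refine continuousOn_comap (f := f) (A := fun y => stretch (a y) (b y))
    (B := fun y => stretch (a y)⁻¹ (b y)⁻¹) hf (hcont ha hb) ?_ ?_ ?_
  · exact hcont (a := fun y => (a y)⁻¹) (b := fun y => (b y)⁻¹) (ha.inv₀ ha0) (hb.inv₀ hb0)
  · intro y hy v
    simp [ha0 y hy, hb0 y hy]
  · intro y hy v
    simp [ha0 y hy, hb0 y hy]

theorem continuous_comap_shear {f : Y → ChabautySpace (V × W)} {τ : Y → V →L[ℝ] W}
    (hf : Continuous f) (hτ : Continuous τ) : Continuous fun y => comap (shear (τ y)) (f y) := by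
  refine continuousOn_univ.1 <| continuousOn_comap (B := fun y => shear (-τ y)) hf.continuousOn
    (Continuous.continuousOn ?_) (Continuous.continuousOn ?_) (fun y _ v => ?_) (fun y _ v => ?_)
  · simp only [shear_apply]
    fun_prop
  · simp only [shear_apply]
    fun_prop
  · simp
  · simp

theorem tendsto_comap_stretch_axis {ι : Type*} {l : Filter ι} {t : ι → ℝ}
    {f : ι → ChabautySpace (V × W)} (ht : Tendsto t l (𝓝[≠] 0))
    (hf : ∀ᶠ i in l, f i ∈ straightSubgroups V W) :
    Tendsto (fun i => comap (stretch (t i)⁻¹ (t i)) (f i)) l (𝓝 (axis V W)) := by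
  have htrace := tendsto_dilate_inv_wholeGroup ht (hf.mono fun i hi => hi.2)
  obtain ⟨ht, ht0⟩ := tendsto_nhdsWithin_iff.1 ht
  refine tendsto_of_eventually_mem (fun v hv O hO => ?_) fun w => ?_
  · have hO' : (fun x : V => (x, (0 : W))) ⁻¹' O ∈ 𝓝 v.1 :=
      (Continuous.prodMk_left 0).tendsto' _ v (Prod.ext rfl (mem_axis.1 hv).symm) hO
    filter_upwards [eventually_exists_mem_of_tendsto htrace (mem_wholeGroup v.1) hO']
    rintro i ⟨x, hxO, hx⟩
    exact ⟨(x, 0), hxO, by simpa using hx⟩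
  · have hsmul : Tendsto (fun p : ι × (V × W) => ‖t p.1 • p.2.2‖) (l ×ˢ 𝓝 w) (𝓝 0) := by
      simpa using ((ht.comp tendsto_fst).smul
        ((continuous_snd.tendsto w).comp tendsto_snd)).norm
    filter_upwards [tendsto_fst.eventually hf, tendsto_fst.eventually ht0,
      hsmul.eventually (eventually_lt_nhds one_pos)] with p hp hp0 hp1 hmem
    exact mem_axis.2 ((smul_eq_zero.1 (hp.1 _ hmem hp1)).resolve_left hp0)

theorem tendsto_comap_stretch_prod_trace {Γ : ChabautySpace (V × W)}
    (hΓ : Γ ∈ straightSubgroups V W) :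
    Tendsto (fun t => comap (stretch 1 t) Γ) (𝓝[≠] 0) (𝓝 (prod (trace Γ) (trivialSubgroup W))) := by
  refine tendsto_of_eventually_mem (fun v hv O hO => ?_) fun w => ?_
  · have hv2 : v.2 = 0 := hv.2
    exact .of_forall fun t => ⟨v, mem_of_mem_nhds hO, by simpa [hv2] using mem_trace.1 hv.1⟩
  · have hsmul : Tendsto (fun p : ℝ × (V × W) => ‖p.1 • p.2.2‖) (𝓝[≠] 0 ×ˢ 𝓝 w) (𝓝 0) := by
      refine Tendsto.mono_left ?_ (prod_mono nhdsWithin_le_nhds le_rfl)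
      rw [← nhds_prod_eq]
      exact Continuous.tendsto' (by fun_prop) _ _ (by simp)
    filter_upwards [tendsto_fst.eventually eventually_mem_nhdsWithin,
      hsmul.eventually (eventually_lt_nhds one_pos)] with p hp0 hp1 hmem
    have hp2 : p.2.2 = 0 := (smul_eq_zero.1 (hΓ.1 _ hmem hp1)).resolve_left hp0
    exact ⟨mem_trace.2 (by simpa [hp2] using hmem), hp2⟩

end NearAxis

section Straightening

variable {V W : Type*} [NormedAddCommGroup V] [NormedSpace ℝ V] [FiniteDimensional ℝ V]
  [NormedAddCommGroup W] [NormedSpace ℝ W] [FiniteDimensional ℝ W]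

theorem exists_continuous_straightening :
    ∃ τ : nearAxis V W → V →L[ℝ] W, Continuous τ ∧ ∀ Γ : nearAxis V W,
      comap (shear (τ Γ)) (Γ : ChabautySpace (V × W)) ∈ straightSubgroups V W := by
  choose τ hτ hτΓ using fun Γ : nearAxis V W => Γ.2
  refine ⟨τ, ?_, hτΓ⟩
  let Q := closedBall (0 : V →L[ℝ] W) (1 / 8)
  have : CompactSpace Q := isCompact_iff_compactSpace.1 (isCompact_closedBall _ _)
  -- The graph of `τ` is closed by uniqueness, and its values lie in the compact `Q`.
  let graph : Set (nearAxis V W × Q) :=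
    {p | comap (shear (p.2 : V →L[ℝ] W)) (p.1 : ChabautySpace (V × W)) ∈ straightSubgroups V W}
  have hgraph : IsClosed graph := isClosed_straightSubgroups.preimage
    (continuous_comap_shear (by fun_prop) (by fun_prop))
  rw [continuous_iff_isClosed]
  intro s hs
  convert! isClosedMap_fst_of_compactSpace (X := nearAxis V W) (Y := Q) _
    (hgraph.inter ((hs.preimage continuous_subtype_val).preimage continuous_snd)) using 1
  ext Γ
  constructor
  · exact fun hΓ => ⟨(Γ, ⟨τ Γ, by simpa [Q] using hτ Γ⟩), ⟨hτΓ Γ, hΓ⟩, rfl⟩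
  · rintro ⟨⟨Γ, ρ, hρ⟩, ⟨hρΓ, hρs⟩, rfl⟩
    have heq := eq_of_comap_shear_mem_straightSubgroups (hτ Γ) (by simpa [Q] using hρ) (hτΓ Γ) hρΓ
    exact (congrArg (· ∈ s) heq).mpr hρs

theorem nullhomotopic_straightSubgroups_val :
    (⟨Subtype.val, continuous_subtype_val⟩ :
      C(straightSubgroups V W, ChabautySpace (V × W))).Nullhomotopic := by
  refine nullhomotopic_of_tendsto (F := fun p : ℝ × straightSubgroups V W =>
    comap (stretch p.1⁻¹ p.1) (p.2 : ChabautySpace (V × W))) (z := axis V W) ?_ (fun Γ => ?_) _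
    fun Γ => SetLike.ext fun v => by simp
  · have hpos : ∀ p ∈ Ioi (0 : ℝ) ×ˢ (univ : Set (straightSubgroups V W)), p.1 ≠ 0 :=
      fun p hp => ne_of_gt hp.1
    exact continuousOn_comap_stretch (by fun_prop) (.inv₀ (by fun_prop) hpos) (by fun_prop)
      (fun p hp => inv_ne_zero (hpos p hp)) hpos
  · exact tendsto_comap_stretch_axis (tendsto_fst.mono_right (nhdsGT_le_nhdsNE 0))
      (.of_forall fun p => p.2.2)

theorem homotopicallyTrivialIn_nearAxis : HomotopicallyTrivialIn (nearAxis V W) := by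
  obtain ⟨τ, hτ, hτΓ⟩ := exists_continuous_straightening (V := V) (W := W)
  let straighten : C(nearAxis V W, straightSubgroups V W) :=
    ⟨fun Γ => ⟨comap (shear (τ Γ)) (Γ : ChabautySpace (V × W)), hτΓ Γ⟩,
      (continuous_comap_shear continuous_subtype_val hτ).subtype_mk _⟩
  obtain ⟨Γ₀, hΓ₀⟩ := nullhomotopic_straightSubgroups_val.comp_left straighten
  refine .of_nullhomotopic ⟨Γ₀, .trans ⟨⟨⟨fun p =>
    comap (shear ((p.1 : ℝ) • τ p.2)) (p.2 : ChabautySpace (V × W)), ?_⟩, ?_, ?_⟩⟩ hΓ₀⟩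
  · exact continuous_comap_shear (by fun_prop) (by fun_prop)
  · simp
  · simp [straighten]

end Straightening

section Neighbourhood

theorem exists_basis_sum_norm_lt (V : Type*) [NormedAddCommGroup V] [NormedSpace ℝ V]
    [FiniteDimensional ℝ V] {ε : ℝ} (hε : 0 < ε) :
    ∃ b : Module.Basis (Fin (Module.finrank ℝ V)) ℝ V, ∑ i, ‖b i‖ < ε := by
  let b := Module.finBasis ℝ V
  have hcont : Continuous fun c : ℝ => ∑ i, ‖c • b i‖ := by fun_prop
  have hsmall : ∀ᶠ c in 𝓝[≠] (0 : ℝ), ∑ i, ‖c • b i‖ < ε :=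
    (hcont.tendsto' 0 0 (by simp)).mono_left nhdsWithin_le_nhds |>.eventually_lt_const hε
  obtain ⟨c, hc, hc0⟩ := (hsmall.and eventually_mem_nhdsWithin).exists
  exact ⟨b.isUnitSMul fun _ => IsUnit.mk0 c hc0, by simpa [Module.Basis.isUnitSMul_apply] using hc⟩

variable {V W : Type*} [NormedAddCommGroup V] [NormedSpace ℝ V] [NormedAddCommGroup W]
  [NormedSpace ℝ W] {ι : Type*}

theorem continuous_constrL [Finite ι] (b : Module.Basis ι ℝ V) :
    Continuous fun q : ι → W => b.constrL q := by
  cases nonempty_fintype ι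
  have : FiniteDimensional ℝ V := b.finiteDimensional_of_finite
  have hsum (q : ι → W) :
      b.constrL q = ∑ i, ContinuousLinearMap.smulRightL ℝ V W (b.coord i).toContinuousLinearMap
        (q i) := by
    ext x
    simp [Module.Basis.constrL_apply, Module.Basis.equivFun_apply]
  simp only [hsum]
  fun_prop

theorem eventually_exists_basis_graph [Finite ι] (b : Module.Basis ι ℝ V) {ε : ℝ}
    (hε : 0 < ε) :
    ∀ᶠ q in 𝓝 fun i => (b i, (0 : W)), ∃ (b' : Module.Basis ι ℝ V) (τ : V →L[ℝ] W),
      ‖τ‖ ≤ ε ∧ ∀ i, q i = (b' i, τ (b' i)) := by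
  cases nonempty_fintype ι
  have : FiniteDimensional ℝ V := b.finiteDimensional_of_finite
  have : CompleteSpace V := FiniteDimensional.complete ℝ V
  let P (q : ι → V × W) : V →L[ℝ] V := b.constrL fun i => (q i).1
  let R (q : ι → V × W) : V →L[ℝ] W := b.constrL fun i => (q i).2
  let q₀ : ι → V × W := fun i => (b i, 0)
  have hP : Continuous P := (continuous_constrL b).comp (by fun_prop)
  have hR : Continuous R := (continuous_constrL b).comp (by fun_prop)
  have hP₀ : P q₀ = 1 :=
    ContinuousLinearMap.coe_injective (b.ext fun i => b.constrL_basis _ i)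
  have hR₀ : R q₀ = 0 :=
    ContinuousLinearMap.coe_injective (b.ext fun i => b.constrL_basis _ i)
  have hunit : ∀ᶠ q in 𝓝 q₀, IsUnit (P q) :=
    hP.continuousAt.eventually (Units.isOpen.mem_nhds (hP₀ ▸ isUnit_one))
  have hinv : ContinuousAt (fun q => Ring.inverse (P q)) q₀ :=
    ContinuousAt.comp (g := Ring.inverse) (hP₀ ▸ NormedRing.inverse_continuousAt 1) hP.continuousAt
  have hnorm : ∀ᶠ q in 𝓝 q₀, ‖R q ∘L Ring.inverse (P q)‖ < ε :=
    (hR.continuousAt.clm_comp hinv).norm.eventually_lt_const (by simpa [hR₀] using hε)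
  filter_upwards [hunit, hnorm] with q ⟨u, hu⟩ hq
  rw [← hu, Ring.inverse_unit] at hq
  refine ⟨b.map (ContinuousLinearEquiv.ofUnit u).toLinearEquiv, _, hq.le, fun i => ?_⟩
  have hPb : (u : V →L[ℝ] V) (b i) = (q i).1 := by simp [hu, P]
  have hinv : (↑u⁻¹ : V →L[ℝ] V) ((u : V →L[ℝ] V) (b i)) = b i :=
    congrArg (· (b i)) u.inv_mul
  change q i = ((u : V →L[ℝ] V) (b i), R q ((↑u⁻¹ : V →L[ℝ] V) ((u : V →L[ℝ] V) (b i))))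
  rw [hinv, hPb]
  simp [R]

theorem mem_denseSubgroups_of_basis [Fintype ι] {Γ : ChabautySpace V}
    (b : Module.Basis ι ℝ V) (hb : ∀ i, b i ∈ Γ) (hsum : ∑ i, ‖b i‖ ≤ 1) :
    Γ ∈ denseSubgroups V := by
  have hspan : Submodule.span ℤ (range b) ≤ AddSubgroup.toIntSubmodule Γ.toAddSubgroup :=
    Submodule.span_le.2 (range_subset_iff.2 hb)
  refine fun x => ⟨ZSpan.floor b x, hspan (ZSpan.floor b x).2, ?_⟩
  rw [norm_sub_rev]
  exact (ZSpan.norm_fract_le b x).trans hsum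

theorem comap_shear_mem_straightSubgroups {Γ : ChabautySpace (V × W)} {τ : V →L[ℝ] W}
    (hτ : ‖τ‖ ≤ 1 / 8) (hdense : trace (comap (shear τ) Γ) ∈ denseSubgroups V)
    (hgap : ∀ v ∈ Γ, ‖v.1‖ ≤ 1 → ‖v.2‖ ∉ Icc (3 / 8) (9 / 8 : ℝ)) :
    comap (shear τ) Γ ∈ straightSubgroups V W := by
  refine ⟨fun v hv hv1 => by_contra fun hv0 => ?_, hdense⟩
  obtain ⟨k, hk⟩ := exists_nsmul_norm_mem_Icc hv0 hv1.le
  obtain ⟨x, hx, hxv⟩ := hdense (k • v.1)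
  have hmem : shear τ (k • v - (x, 0)) ∈ Γ := sub_mem (nsmul_mem hv k) (mem_trace.1 hx)
  have hτx : ‖τ (k • v.1 - x)‖ ≤ 1 / 8 := by
    rw [norm_sub_rev] at hxv
    exact (τ.le_opNorm _).trans ((mul_le_of_le_one_right (norm_nonneg τ) hxv).trans hτ)
  have hclose := abs_norm_sub_norm_le (k • v.2 + τ (k • v.1 - x)) (k • v.2)
  rw [add_sub_cancel_left, abs_le] at hclose
  refine hgap _ hmem (by simpa [norm_sub_rev] using hxv) ?_
  simp only [shear_apply, Prod.snd_sub, Prod.smul_snd, Prod.fst_sub, Prod.smul_fst, sub_zero]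
  constructor <;> linarith [hk.1, hk.2]

variable [FiniteDimensional ℝ V]

theorem eventually_exists_dense_trace :
    ∀ᶠ Γ in 𝓝 (axis V W), ∃ τ : V →L[ℝ] W,
      ‖τ‖ ≤ 1 / 8 ∧ trace (comap (shear τ) Γ) ∈ denseSubgroups V := by
  obtain ⟨b, hb⟩ := exists_basis_sum_norm_lt V one_pos
  have hsum : ∀ᶠ q in 𝓝 fun i => (b i, (0 : W)), ∑ i, ‖(q i).1‖ < 1 :=
    (Continuous.tendsto (by fun_prop) _).eventually_lt_const hb
  obtain ⟨δ, hδ, hball⟩ := Metric.eventually_nhds_iff_ball.1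
    (hsum.and (eventually_exists_basis_graph (W := W) b (by norm_num : (0 : ℝ) < 1 / 8)))
  have hhit : ∀ᶠ Γ in 𝓝 (axis V W), ∀ i, ∃ v ∈ ball (b i, (0 : W)) δ, v ∈ Γ :=
    eventually_all.2 fun i => (isOpen_setOf_exists_mem isOpen_ball).mem_nhds
      ⟨_, mem_ball_self hδ, mem_axis.2 rfl⟩
  filter_upwards [hhit] with Γ hΓ
  choose q hq hqΓ using hΓ
  obtain ⟨hq1, b', τ, hτ, hqτ⟩ := hball q ((dist_pi_lt_iff hδ).2 hq)
  refine ⟨τ, hτ, mem_denseSubgroups_of_basis b' (fun i => ?_) (by simpa [hqτ] using hq1.le)⟩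
  simpa [← hqτ] using hqΓ i

theorem nearAxis_mem_nhds [FiniteDimensional ℝ W] : nearAxis V W ∈ 𝓝 (axis V W) := by
  have hK : IsCompact (closedBall (0 : V) 1 ×ˢ (closedBall (0 : W) (9 / 8) \ ball 0 (3 / 8))) :=
    (isCompact_closedBall _ _).prod ((isCompact_closedBall _ _).diff isOpen_ball)
  have hmiss := (isOpen_setOf_forall_notMem hK).mem_nhds fun v hv (hvΓ : v ∈ axis V W) =>
    hv.2.2 (by simp [mem_axis.1 hvΓ])
  filter_upwards [eventually_exists_dense_trace, hmiss] with Γ ⟨τ, hτ, hdense⟩ hΓ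
  refine ⟨τ, hτ, comap_shear_mem_straightSubgroups hτ hdense fun v hv hv1 hv2 => hΓ v ?_ hv⟩
  simpa using ⟨hv1, hv2.2, hv2.1⟩

end Neighbourhood

section MaxSubspace

variable {E : Type*} [NormedAddCommGroup E] [NormedSpace ℝ E]

/-- The largest linear subspace contained in a closed subgroup. -/
def maxSubspace (Γ : ChabautySpace E) : Submodule ℝ E where
  carrier := {v | ∀ s : ℝ, s • v ∈ Γ}
  add_mem' hv hw s := by rw [smul_add]; exact add_mem (hv s) (hw s)
  zero_mem' s := by rw [smul_zero]; exact zero_mem _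
  smul_mem' c v hv s := by rw [smul_smul]; exact hv _

theorem mem_maxSubspace {Γ : ChabautySpace E} {v : E} : v ∈ maxSubspace Γ ↔ ∀ s : ℝ, s • v ∈ Γ :=
  Iff.rfl

theorem mem_of_mem_maxSubspace {Γ : ChabautySpace E} {v : E} (hv : v ∈ maxSubspace Γ) : v ∈ Γ := by
  simpa using hv 1

theorem tendsto_floor_div_mul (s : ℝ) :
    Tendsto (fun t : ℝ => (⌊s / t⌋ : ℝ) * t) (𝓝[≠] 0) (𝓝 s) := by
  rw [tendsto_iff_dist_tendsto_zero]
  refine squeeze_zero' (.of_forall fun t => dist_nonneg) ?_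
    (continuous_abs.tendsto' (0 : ℝ) 0 abs_zero |>.mono_left nhdsWithin_le_nhds)
  filter_upwards [eventually_mem_nhdsWithin] with t ht
  calc dist (⌊s / t⌋ * t) s = |Int.fract (s / t) * t| := by
        rw [dist_comm, Real.dist_eq, ← Int.self_sub_floor, sub_mul, div_mul_cancel₀ _ ht]
    _ ≤ |t| := by
        rw [abs_mul, Int.abs_fract]
        exact mul_le_of_le_one_left (abs_nonneg t) (Int.fract_lt_one _).le

variable [FiniteDimensional ℝ E]

/-- A linear subspace, as a closed subgroup. -/
def ofSubmodule (V : Submodule ℝ E) : ChabautySpace E where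
  toAddSubgroup := V.toAddSubgroup
  isClosed' := V.closed_of_finiteDimensional

@[simp]
theorem mem_ofSubmodule {V : Submodule ℝ E} {v : E} : v ∈ ofSubmodule V ↔ v ∈ V := Iff.rfl

theorem tendsto_dilate_ofSubmodule_maxSubspace (Γ : ChabautySpace E) :
    Tendsto (fun t : ℝ => dilate t Γ) (𝓝[≠] 0) (𝓝 (ofSubmodule (maxSubspace Γ))) := by
  refine tendsto_nhds_iff.2
    ⟨fun v hv O hO => .of_forall fun t => ⟨v, mem_of_mem_nhds hO, hv t⟩, fun w hw => ?_⟩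
  obtain ⟨s, hs⟩ := not_forall.1 hw
  have hsw : Tendsto (fun p : ℝ × E => ((⌊s / p.1⌋ : ℝ) * p.1) • p.2) (𝓝[≠] 0 ×ˢ 𝓝 w)
      (𝓝 (s • w)) := ((tendsto_floor_div_mul s).comp tendsto_fst).smul tendsto_snd
  filter_upwards [hsw.eventually (Γ.isClosed_coe.isOpen_compl.eventually_mem hs)] with p hp hpΓ
  refine hp ?_
  rw [mul_smul, Int.cast_smul_eq_zsmul]
  exact zsmul_mem (mem_dilate.1 hpΓ) ⌊s / p.1⌋

theorem mem_discreteSubgroups_of_maxSubspace_eq_bot {Γ : ChabautySpace E}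
    (hΓ : maxSubspace Γ = ⊥) : Γ ∈ discreteSubgroups E := by
  have hbot : ofSubmodule (maxSubspace Γ) = trivialSubgroup E :=
    SetLike.ext fun v => by simp [hΓ]
  have hnhds := eventually_eq_zero_of_mem (trivialSubgroup_mem_discreteSubgroups (G := E))
  obtain ⟨t, ht, ht0⟩ := (((hbot ▸ tendsto_dilate_ofSubmodule_maxSubspace Γ).eventually
    hnhds.curry).and eventually_mem_nhdsWithin).exists
  rw [mem_discreteSubgroups_iff]
  have hsmul : Tendsto (fun v : E => t⁻¹ • v) (𝓝 0) (𝓝 0) :=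
    Continuous.tendsto' (by fun_prop) _ _ (smul_zero _)
  filter_upwards [hsmul.eventually ht] with v hv hvΓ
  exact (smul_eq_zero.1 (hv (by simpa [smul_inv_smul₀ ht0] using hvΓ))).resolve_left
    (inv_ne_zero ht0)

end MaxSubspace

end ChabautySpace

section GeneralLinear

open Matrix

variable {ι : Type*}

section Matrix

variable [Fintype ι] [DecidableEq ι]

theorem joinedIn_isUnit_diagonal {D D' : ι → ℝ} (hD : ∀ i, 0 < D' i * D i) :
    JoinedIn {M : Matrix ι ι ℝ | IsUnit M} (diagonal D) (diagonal D') := by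
  let S : Set (ι → ℝ) := univ.pi fun i => {x | 0 < D' i * x}
  have hS : Convex ℝ S := convex_pi fun i _ =>
    convex_halfSpace_gt (IsLinearMap.isLinearMap_smul (D' i)) 0
  have hDS : D ∈ S := fun i _ => hD i
  have hDS' : D' ∈ S := fun i _ => mul_self_pos.2 (left_ne_zero_of_mul (hD i).ne')
  refine (((hS.isPathConnected ⟨D, hDS⟩).joinedIn D hDS D' hDS').map
    (continuous_id.matrix_diagonal)).mono ?_
  rintro _ ⟨x, hx, rfl⟩
  exact isUnit_diagonal.2 (Pi.isUnit_iff.2 fun i =>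
    (right_ne_zero_of_mul (hx i (mem_univ i)).ne').isUnit)

theorem joinedIn_isUnit_transvection {i j : ι} (hij : i ≠ j) (c : ℝ) :
    JoinedIn {M : Matrix ι ι ℝ | IsUnit M} (transvection i j c) 1 := by
  have hcont : Continuous fun x : ℝ => transvection i j x := by
    refine continuous_const.add (continuous_matrix fun k l => ?_)
    simp only [single_apply]
    split_ifs <;> fun_prop
  rw [← transvection_zero (R := ℝ) i j]
  refine ((isPathConnected_univ.joinedIn c trivial 0 trivial).map hcont).mono ?_
  rintro _ ⟨x, -, rfl⟩
  simp [isUnit_iff_isUnit_det, det_transvection_of_ne _ _ hij]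

theorem exists_joinedIn_isUnit_diagonal_units {M : Matrix ι ι ℝ} (hM : IsUnit M) :
    ∃ ε : ι → ℤˣ, JoinedIn {M : Matrix ι ι ℝ | IsUnit M} M (diagonal fun i => ((ε i : ℤ) : ℝ)) := by
  refine diagonal_transvection_induction_of_det_ne_zero (fun M => ∃ ε : ι → ℤˣ,
    JoinedIn {M : Matrix ι ι ℝ | IsUnit M} M (diagonal fun i => ((ε i : ℤ) : ℝ))) M
    ((isUnit_iff_isUnit_det M).1 hM).ne_zero (fun D hD => ?_) (fun T => ?_) ?_
  · have hD0 : ∀ i, D i ≠ 0 := by simpa [det_diagonal, Finset.prod_ne_zero_iff] using hD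
    have hsign (i : ι) : ∃ e : ℤˣ, 0 < ((e : ℤ) : ℝ) * D i := by
      rcases (hD0 i).lt_or_gt with h | h
      · exact ⟨-1, by simpa using h⟩
      · exact ⟨1, by simpa using h⟩
    choose ε hε using hsign
    exact ⟨ε, joinedIn_isUnit_diagonal hε⟩
  · exact ⟨1, by simpa [TransvectionStruct.toMatrix] using
      joinedIn_isUnit_transvection T.hij T.c⟩
  · rintro A B - - ⟨ε, hε⟩ ⟨δ, hδ⟩
    refine ⟨ε * δ, ?_⟩
    have hmul := hε.mul hδ
    rw [diagonal_mul_diagonal] at hmul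
    simpa using hmul.mono (mul_subset_iff.2 fun _ h _ h' => h.mul h')

end Matrix

theorem exists_joinedIn_isUnit_apply_basis [Finite ι] {V : Type*} [NormedAddCommGroup V]
    [NormedSpace ℝ V] (b : Module.Basis ι ℝ V) {A : V →L[ℝ] V} (hA : IsUnit A) :
    ∃ (B : V →L[ℝ] V) (ε : ι → ℤˣ), JoinedIn {A : V →L[ℝ] V | IsUnit A} A B ∧
      ∀ i, B (b i) = (ε i : ℤ) • b i := by
  classical
  cases nonempty_fintype ι
  have : FiniteDimensional ℝ V := b.finiteDimensional_of_finite
  let φ := (toLinAlgEquiv b).trans (Module.End.toContinuousLinearMap V)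
  have hφ : Continuous φ := LinearMap.continuous_of_finiteDimensional φ.toLinearMap
  obtain ⟨ε, hε⟩ := exists_joinedIn_isUnit_diagonal_units (hA.map φ.symm)
  refine ⟨φ (diagonal fun i => ((ε i : ℤ) : ℝ)), ε, ?_, fun i => ?_⟩
  · rw [← φ.apply_symm_apply A]
    exact (hε.map hφ).mono (image_subset_iff.2 fun M hM => hM.map φ)
  · change toLinAlgEquiv b _ (b i) = _
    simp [toLinAlgEquiv_self, diagonal_apply, Int.cast_smul_eq_zsmul]

end GeneralLinear

theorem continuousOn_ringInverse {R : Type*} [NormedRing R] [HasSummableGeomSeries R] :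
    ContinuousOn (Ring.inverse : R → R) {a | IsUnit a} := by
  rintro _ ⟨u, rfl⟩
  exact (NormedRing.inverse_continuousAt u).continuousWithinAt

namespace ChabautySpace

section Comap

variable {E : Type*} [NormedAddCommGroup E] [NormedSpace ℝ E] {Γ : ChabautySpace E}

theorem dilate_comap_mem_denseSubgroups (hΓ : Γ ∈ denseSubgroups E) {A : E →L[ℝ] E}
    (hA : IsUnit A) {r : ℝ} (hr : 0 < r) (hAr : ‖Ring.inverse A‖ ≤ r) :
    dilate r (comap A Γ) ∈ denseSubgroups E := by
  refine (dilate_mem_denseSubgroups_iff hr.ne').2 fun x => ?_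
  obtain ⟨y, hy, hyx⟩ := hΓ (A x)
  have hleft (v : E) : Ring.inverse A (A v) = v := congrArg (· v) (Ring.inverse_mul_cancel A hA)
  have hright (v : E) : A (Ring.inverse A v) = v := congrArg (· v) (Ring.mul_inverse_cancel A hA)
  refine ⟨Ring.inverse A y, by simpa [hright] using hy, ?_⟩
  calc ‖Ring.inverse A y - x‖ = ‖Ring.inverse A (y - A x)‖ := by rw [map_sub, hleft]
    _ ≤ ‖Ring.inverse A‖ * 1 := (Ring.inverse A).le_opNorm_of_le hyx
    _ ≤ |r| := by rw [mul_one, abs_of_pos hr]; exact hAr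

variable [ProperSpace E]

theorem continuousOn_comap_isUnit (Γ : ChabautySpace E) :
    ContinuousOn (fun A : E →L[ℝ] E => comap A Γ) {A | IsUnit A} := by
  have hinv : ContinuousOn (fun p : (E →L[ℝ] E) × E => Ring.inverse p.1)
      ({A | IsUnit A} ×ˢ univ) :=
    continuousOn_ringInverse.comp continuousOn_fst fun p hp => hp.1
  refine continuousOn_comap (f := fun _ => Γ) (A := fun A : E →L[ℝ] E => A)
    (B := fun A => (Ring.inverse A : E →L[ℝ] E)) continuousOn_const (by fun_prop) ?_
    (fun A hA v => ?_) fun A hA v => ?_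
  · exact hinv.clm_apply continuousOn_snd
  · exact congrArg (· v) (Ring.inverse_mul_cancel A hA)
  · exact congrArg (· v) (Ring.mul_inverse_cancel A hA)

theorem joinedIn_dilate (hdense : Γ ∈ denseSubgroups E) (hdisc : Γ ∈ discreteSubgroups E) {t : ℝ}
    (ht : 1 ≤ t) : JoinedIn (denseSubgroups E ∩ discreteSubgroups E) Γ (dilate t Γ) := by
  have hcont : ContinuousOn (fun s => dilate s Γ) (Ici 1) :=
    continuousOn_dilate.comp (f := fun s : ℝ => (s, Γ)) (by fun_prop)
      fun s (hs : 1 ≤ s) => ⟨(one_pos.trans_le hs).ne', trivial⟩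
  have hjoined := (((convex_Ici (1 : ℝ)).isPathConnected nonempty_Ici).joinedIn 1 self_mem_Ici t
    ht).map_continuousOn hcont
  rw [dilate_one] at hjoined
  refine hjoined.mono (image_subset_iff.2 fun s (hs : 1 ≤ s) => ?_)
  exact ⟨dilate_mem_denseSubgroups hdense hs,
    dilate_mem_discreteSubgroups (one_pos.trans_le hs).ne' hdisc⟩

-- Along a path of operators `A` the groups `comap A Γ` become dense after dilation by `‖A⁻¹‖`.
theorem joinedIn_comap (hdense : Γ ∈ denseSubgroups E) (hdisc : Γ ∈ discreteSubgroups E)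
    {A B : E →L[ℝ] E} (hAB : JoinedIn {A : E →L[ℝ] E | IsUnit A} A B)
    (hA : comap A Γ ∈ denseSubgroups E) (hB : comap B Γ ∈ denseSubgroups E) :
    JoinedIn (denseSubgroups E ∩ discreteSubgroups E) (comap A Γ) (comap B Γ) := by
  let r (A : E →L[ℝ] E) : ℝ := max 1 ‖Ring.inverse A‖
  have hr (A) : 1 ≤ r A := le_max_left _ _
  have hrpos (A) : 0 < r A := one_pos.trans_le (hr A)
  have hcont : ContinuousOn (fun A => dilate (r A) (comap A Γ)) {A : E →L[ℝ] E | IsUnit A} :=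
    continuousOn_dilate.comp (f := fun A : E →L[ℝ] E => (r A, comap A Γ))
      ((continuousOn_const.sup continuousOn_ringInverse.norm).prodMk (continuousOn_comap_isUnit Γ))
      fun A _ => ⟨(hrpos A).ne', trivial⟩
  have hdiscrete {A : E →L[ℝ] E} (hA : IsUnit A) : comap A Γ ∈ discreteSubgroups E :=
    comap_mem_discreteSubgroups
      (Function.LeftInverse.injective (g := (Ring.inverse A : E →L[ℝ] E)) fun v =>
        congrArg (· v) (Ring.inverse_mul_cancel A hA)) hdisc
  have hmiddle : JoinedIn (denseSubgroups E ∩ discreteSubgroups E) (dilate (r A) (comap A Γ))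
      (dilate (r B) (comap B Γ)) :=
    (hAB.map_continuousOn hcont).mono <| image_subset_iff.2 fun A hA =>
      ⟨dilate_comap_mem_denseSubgroups hdense hA (hrpos A) (le_max_right _ _),
        dilate_mem_discreteSubgroups (hrpos A).ne' (hdiscrete hA)⟩
  exact (joinedIn_dilate hA (hdiscrete hAB.source_mem) (hr A)).trans
    (hmiddle.trans (joinedIn_dilate hB (hdiscrete hAB.target_mem) (hr B)).symm)

end Comap

section Lattice

variable {V : Type*} [NormedAddCommGroup V] [NormedSpace ℝ V] {ι : Type*}

/-- The lattice spanned by a basis, as a closed subgroup. -/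
def basisLattice [Finite ι] (b : Module.Basis ι ℝ V) : ChabautySpace V where
  toAddSubgroup := (Submodule.span ℤ (range b)).toAddSubgroup
  isClosed' := AddSubgroup.isClosed_of_discrete

theorem mem_basisLattice [Finite ι] {b : Module.Basis ι ℝ V} {v : V} :
    v ∈ basisLattice b ↔ v ∈ Submodule.span ℤ (range b) :=
  Iff.rfl

theorem basisLattice_mem_discreteSubgroups [Finite ι] (b : Module.Basis ι ℝ V) :
    basisLattice b ∈ discreteSubgroups V :=
  show DiscreteTopology (Submodule.span ℤ (range b)).toAddSubgroup from inferInstance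

theorem basisLattice_mem_denseSubgroups [Fintype ι] {b : Module.Basis ι ℝ V}
    (hb : ∑ i, ‖b i‖ ≤ 1) : basisLattice b ∈ denseSubgroups V :=
  mem_denseSubgroups_of_basis b (fun i => Submodule.subset_span (mem_range_self i)) hb

theorem comap_equiv_basisLattice [Finite ι] (b b' : Module.Basis ι ℝ V) {A : V →L[ℝ] V}
    (hA : ∀ i, A (b i) = b' i) : comap A (basisLattice b') = basisLattice b := by
  have hAb : (A : V →ₗ[ℝ] V) = b.equiv b' (Equiv.refl ι) := b.ext fun i => by simp [hA]
  refine SetLike.ext fun v => ?_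
  have hAv : b'.repr (A v) = b.repr v := by
    rw [← ContinuousLinearMap.coe_coe, hAb]
    ext i
    simp [Module.Basis.equiv]
  rw [mem_comap, mem_basisLattice, mem_basisLattice, b'.mem_span_iff_repr_mem ℤ, hAv,
    b.mem_span_iff_repr_mem ℤ]

theorem comap_sign_basisLattice [Finite ι] (b : Module.Basis ι ℝ V) {B : V →L[ℝ] V} {ε : ι → ℤˣ}
    (hB : ∀ i, B (b i) = (ε i : ℤ) • b i) : comap B (basisLattice b) = basisLattice b := by
  have hmaps : ∀ v ∈ basisLattice b, B v ∈ basisLattice b := by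
    have hspan : Submodule.span ℤ (range b) ≤
        AddSubgroup.toIntSubmodule (comap B (basisLattice b)).toAddSubgroup := by
      rw [Submodule.span_le, range_subset_iff]
      intro i
      change B (b i) ∈ basisLattice b
      rw [hB]
      exact zsmul_mem (mem_basisLattice.2 (Submodule.subset_span (mem_range_self i))) _
    exact fun v hv => hspan hv
  have hBB : B * B = 1 := ContinuousLinearMap.coe_injective <| b.ext fun i => by
    simp [hB, smul_smul, ← Units.val_mul]
  refine SetLike.ext fun v => ⟨fun hv => ?_, hmaps v⟩
  have hBBv : B (B v) = v := congrArg (· v) hBB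
  exact hBBv ▸ hmaps _ hv

variable [FiniteDimensional ℝ V]

theorem span_eq_top_of_mem_denseSubgroups {Γ : ChabautySpace V} (hΓ : Γ ∈ denseSubgroups V) :
    Submodule.span ℝ (Γ : Set V) = ⊤ := by
  have hcl := (Submodule.span ℝ (Γ : Set V)).closed_of_finiteDimensional
  have hle (t : ℝ) (ht : t ≠ 0) : (dilate t⁻¹ Γ : Set V) ⊆ Submodule.span ℝ (Γ : Set V) := by
    intro v hv
    rw [← smul_inv_smul₀ ht v]
    exact Submodule.smul_mem _ t (Submodule.subset_span hv)
  refine eq_top_iff.2 fun v _ => hcl.closure_subset ?_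
  rw [mem_closure_iff_nhds]
  intro O hO
  have hlim := tendsto_dilate_inv_wholeGroup (l := 𝓝[≠] (0 : ℝ)) tendsto_id
    (.of_forall fun _ => hΓ)
  obtain ⟨t, ⟨u, huO, hu⟩, ht⟩ := ((eventually_exists_mem_of_tendsto hlim (mem_wholeGroup v)
    hO).and eventually_mem_nhdsWithin).exists
  exact ⟨u, huO, hle t ht hu⟩

theorem exists_eq_basisLattice {Γ : ChabautySpace V} (hdense : Γ ∈ denseSubgroups V)
    (hdisc : Γ ∈ discreteSubgroups V) :
    ∃ b : Module.Basis (Fin (Module.finrank ℝ V)) ℝ V, Γ = basisLattice b := by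
  let L : Submodule ℤ V := AddSubgroup.toIntSubmodule Γ.toAddSubgroup
  have : DiscreteTopology L := hdisc
  have : IsZLattice ℝ L := ⟨span_eq_top_of_mem_denseSubgroups hdense⟩
  have : Module.Free ℤ L := ZLattice.module_free ℝ L
  have : Module.Finite ℤ L := ZLattice.module_finite ℝ L
  let c := Module.Free.chooseBasis ℤ L
  let b := c.ofZLatticeBasis ℝ L
  refine ⟨b.reindex (b.indexEquiv (Module.finBasis ℝ V)), SetLike.ext fun v => ?_⟩
  rw [mem_basisLattice, Module.Basis.range_reindex, c.ofZLatticeBasis_span ℝ]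
  rfl

theorem joinedIn_basisLattice [Finite ι] {b b' : Module.Basis ι ℝ V}
    (hb : basisLattice b ∈ denseSubgroups V) (hb' : basisLattice b' ∈ denseSubgroups V) :
    JoinedIn (denseSubgroups V ∩ discreteSubgroups V) (basisLattice b) (basisLattice b') := by
  let A := (b.equiv b' (Equiv.refl ι)).toContinuousLinearEquiv
  have hA : comap (A : V →L[ℝ] V) (basisLattice b') = basisLattice b :=
    comap_equiv_basisLattice b b' fun i => by simp [A]
  have hAunit : IsUnit (A : V →L[ℝ] V) := ⟨ContinuousLinearEquiv.toUnit A, rfl⟩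
  obtain ⟨B, ε, hAB, hB⟩ := exists_joinedIn_isUnit_apply_basis b' hAunit
  have hBcomap := comap_sign_basisLattice b' hB
  simpa only [hA, hBcomap] using joinedIn_comap hb' (basisLattice_mem_discreteSubgroups b') hAB
    (hA.symm ▸ hb) (hBcomap.symm ▸ hb')

theorem isPathConnected_denseSubgroups_inter_discreteSubgroups :
    IsPathConnected (denseSubgroups V ∩ discreteSubgroups V) := by
  obtain ⟨b, hb⟩ := exists_basis_sum_norm_lt V one_pos
  have hb := basisLattice_mem_denseSubgroups hb.le
  refine ⟨basisLattice b, ⟨hb, basisLattice_mem_discreteSubgroups b⟩, fun {Γ} hΓ => ?_⟩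
  obtain ⟨b', rfl⟩ := exists_eq_basisLattice hΓ.1 hΓ.2
  exact joinedIn_basisLattice hb hΓ.1

end Lattice

section Axis

variable {V W : Type*} [NormedAddCommGroup V] [NormedSpace ℝ V] [NormedAddCommGroup W]
  [NormedSpace ℝ W] {Γ : ChabautySpace (V × W)}

theorem comap_stretch_mem_straightSubgroups (hΓ : Γ ∈ straightSubgroups V W) {t : ℝ}
    (ht : t ∈ Ioc 0 1) : comap (stretch 1 t) Γ ∈ straightSubgroups V W := by
  refine ⟨fun v hv hv1 => ?_, ?_⟩
  · have hsmall : ‖t • v.2‖ < 1 := by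
      rw [norm_smul, Real.norm_of_nonneg ht.1.le]
      exact (mul_le_of_le_one_left (norm_nonneg _) ht.2).trans_lt hv1
    exact (smul_eq_zero.1 (hΓ.1 _ hv hsmall)).resolve_left ht.1.ne'
  · convert! hΓ.2 using 1
    exact SetLike.ext fun x => by simp

theorem prod_trivialSubgroup_mem_straightSubgroups {Λ : ChabautySpace V}
    (hΛ : Λ ∈ denseSubgroups V) : prod Λ (trivialSubgroup W) ∈ straightSubgroups V W := by
  refine ⟨fun v hv _ => hv.2, ?_⟩
  convert! hΛ using 1
  exact SetLike.ext fun x => by simp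

theorem eq_wholeGroup_prod (hΓ : ∀ x : V, (x, 0) ∈ Γ) :
    Γ = prod (wholeGroup V) (comap (ContinuousLinearMap.inr ℝ V W) Γ) := by
  refine SetLike.ext fun v => ?_
  have hadd : (v.1, 0) + (0, v.2) = v := by simp
  rw [← hadd, add_mem_cancel_left (hΓ v.1)]
  simp

variable [FiniteDimensional ℝ V] [FiniteDimensional ℝ W]

theorem joinedIn_comap_shear {τ : V →L[ℝ] W} (hτ : ‖τ‖ ≤ 1 / 8)
    (hΓ : comap (shear τ) Γ ∈ straightSubgroups V W) (hdisc : Γ ∈ discreteSubgroups (V × W)) :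
    JoinedIn (nearAxis V W ∩ discreteSubgroups (V × W)) Γ (comap (shear τ) Γ) := by
  refine ⟨⟨⟨fun t : I => comap (shear ((t : ℝ) • τ)) Γ,
    continuous_comap_shear continuous_const (by fun_prop)⟩, by simp, by simp⟩,
    fun t => ⟨⟨(1 - (t : ℝ)) • τ, ?_, ?_⟩, comap_mem_discreteSubgroups (shear_injective _) hdisc⟩⟩
  · rw [norm_smul, Real.norm_of_nonneg (sub_nonneg.2 t.2.2)]
    exact (mul_le_of_le_one_left (norm_nonneg τ) (sub_le_self 1 t.2.1)).trans hτ
  · convert! hΓ using 1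
    exact SetLike.ext fun v => by simp [add_assoc, ← add_smul]

theorem joinedIn_prod_trace (hΓ : Γ ∈ straightSubgroups V W)
    (hdisc : Γ ∈ discreteSubgroups (V × W)) :
    JoinedIn (straightSubgroups V W ∩ discreteSubgroups (V × W))
      (prod (trace Γ) (trivialSubgroup W)) Γ := by
  have htrace : trace Γ ∈ discreteSubgroups V :=
    comap_mem_discreteSubgroups (LinearMap.inl_injective (R := ℝ)) hdisc
  have hcont : ContinuousOn (fun t => comap (stretch 1 t) Γ) (Ioc 0 1) :=
    continuousOn_comap_stretch continuousOn_const continuousOn_const continuousOn_id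
      (fun _ _ => one_ne_zero) fun t ht => ht.1.ne'
  have hjoined := joinedIn_of_tendsto
    (S := straightSubgroups V W ∩ discreteSubgroups (V × W)) one_pos hcont
    ((tendsto_comap_stretch_prod_trace hΓ).mono_left (nhdsGT_le_nhdsNE 0))
    ⟨prod_trivialSubgroup_mem_straightSubgroups hΓ.2,
      prod_mem_discreteSubgroups htrace trivialSubgroup_mem_discreteSubgroups⟩
    fun t ht => ⟨comap_stretch_mem_straightSubgroups hΓ ht,
      comap_mem_discreteSubgroups (stretch_injective one_ne_zero ht.1.ne') hdisc⟩
  rwa [show comap (stretch 1 1) Γ = Γ from SetLike.ext fun v => by simp] at hjoined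

theorem isPathConnected_nearAxis_inter_discreteSubgroups :
    IsPathConnected (nearAxis V W ∩ discreteSubgroups (V × W)) := by
  have hlattices := isPathConnected_denseSubgroups_inter_discreteSubgroups (V := V)
  have hcont : Continuous fun Λ : ChabautySpace V => prod Λ (trivialSubgroup W) :=
    continuous_iff_continuousAt.2 fun Λ => tendsto_prod tendsto_id tendsto_const_nhds
  have hsub : (fun Λ => prod Λ (trivialSubgroup W)) '' (denseSubgroups V ∩ discreteSubgroups V) ⊆
      nearAxis V W ∩ discreteSubgroups (V × W) := image_subset_iff.2 fun Λ hΛ =>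
    ⟨straightSubgroups_subset_nearAxis (prod_trivialSubgroup_mem_straightSubgroups hΛ.1),
      prod_mem_discreteSubgroups hΛ.2 trivialSubgroup_mem_discreteSubgroups⟩
  obtain ⟨_, ⟨Λ₀, hΛ₀, rfl⟩, hjoined⟩ := hlattices.image hcont
  refine ⟨_, hsub (mem_image_of_mem _ hΛ₀), fun {Γ} hΓ => ?_⟩
  obtain ⟨⟨τ, hτ, hstraight⟩, hdisc⟩ := hΓ
  have hshear := joinedIn_comap_shear hτ hstraight hdisc
  have hflat := (joinedIn_prod_trace hstraight hshear.target_mem.2).mono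
    (inter_subset_inter_left _ straightSubgroups_subset_nearAxis)
  have htrace : trace (comap (shear τ) Γ) ∈ discreteSubgroups V :=
    comap_mem_discreteSubgroups (LinearMap.inl_injective (R := ℝ)) hshear.target_mem.2
  exact ((hjoined ⟨_, ⟨hstraight.2, htrace⟩, rfl⟩).mono hsub).trans (hflat.trans hshear.symm)

theorem locallyTrivialAt_axis : LocallyTrivialAt (discreteSubgroups (V × W)) (axis V W) :=
  ⟨nearAxis V W, nearAxis_mem_nhds, homotopicallyTrivialIn_nearAxis,
    isPathConnected_nearAxis_inter_discreteSubgroups⟩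

theorem accessibleFrom_wholeGroup_prod {Λ : ChabautySpace W} (hΛ : Λ ∈ discreteSubgroups W) :
    AccessibleFrom (discreteSubgroups (V × W)) (prod (wholeGroup V) Λ) := by
  obtain ⟨L, hdense, hdisc⟩ :=
    (isPathConnected_denseSubgroups_inter_discreteSubgroups (V := V)).nonempty
  refine .of_tendsto (f := fun t => prod (dilate t⁻¹ L) Λ) (fun t (ht : 0 < t) => ?_)
    (tendsto_prod (tendsto_dilate_inv_wholeGroup (nhdsGT_le_nhdsNE 0)
      (.of_forall fun _ => hdense)) tendsto_const_nhds)
    fun t ht => prod_mem_discreteSubgroups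
      (dilate_mem_discreteSubgroups (inv_ne_zero ht.ne') hdisc) hΛ
  have hdilate : ContinuousOn (fun t : ℝ => dilate t⁻¹ L) {0}ᶜ :=
    continuousOn_dilate.comp (f := fun t : ℝ => (t⁻¹, L))
      ((continuousOn_id.inv₀ fun _ => id).prodMk continuousOn_const)
      fun t ht => ⟨inv_ne_zero ht, trivial⟩
  exact tendsto_prod ((hdilate t ht.ne').mono fun _ h => ne_of_gt h) tendsto_const_nhds

theorem accessibleFrom_of_mem_maxSubspace_iff (hΓ : ∀ v, v ∈ maxSubspace Γ ↔ v.2 = 0) :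
    AccessibleFrom (discreteSubgroups (V × W)) Γ := by
  rw [eq_wholeGroup_prod fun x => mem_of_mem_maxSubspace ((hΓ (x, 0)).2 rfl)]
  refine accessibleFrom_wholeGroup_prod (mem_discreteSubgroups_of_maxSubspace_eq_bot ?_)
  refine eq_bot_iff.2 fun w hw => (hΓ (0, w)).1 fun s => ?_
  simpa using mem_maxSubspace.1 hw s

end Axis

section Global

variable {E : Type*} [NormedAddCommGroup E] [NormedSpace ℝ E] [FiniteDimensional ℝ E]

theorem exists_equiv_prod (V : Submodule ℝ E) :
    ∃ (W : Submodule ℝ E) (e : E ≃L[ℝ] V × W), ∀ v, v ∈ V ↔ (e v).2 = 0 := by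
  obtain ⟨W, hW⟩ := V.exists_isCompl
  exact ⟨W, (Submodule.prodEquivOfIsCompl V W hW).symm.toContinuousLinearEquiv, fun v => by simp⟩

theorem accessibleFrom_discreteSubgroups (Γ : ChabautySpace E) :
    AccessibleFrom (discreteSubgroups E) Γ := by
  obtain ⟨W, e, he⟩ := exists_equiv_prod (maxSubspace Γ)
  rw [← preimage_congr_discreteSubgroups e.toContinuousAddEquiv]
  refine .preimage _ (accessibleFrom_of_mem_maxSubspace_iff fun v => ?_)
  calc v ∈ maxSubspace (congr e.toContinuousAddEquiv Γ) ↔ e.symm v ∈ maxSubspace Γ :=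
        forall_congr' fun s => by rw [← map_smul e.symm]; rfl
    _ ↔ v.2 = 0 := by rw [he, e.apply_symm_apply]

theorem locallyTrivialAt_ofSubmodule (V : Submodule ℝ E) :
    LocallyTrivialAt (discreteSubgroups E) (ofSubmodule V) := by
  obtain ⟨W, e, he⟩ := exists_equiv_prod V
  have haxis : congr e.toContinuousAddEquiv (ofSubmodule V) = axis V W :=
    SetLike.ext fun v => (he (e.symm v)).trans (by simp)
  rw [← preimage_congr_discreteSubgroups e.toContinuousAddEquiv]
  exact .preimage _ (haxis ▸ locallyTrivialAt_axis)

theorem locallyTrivialAt_discreteSubgroups (Γ : ChabautySpace E) :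
    LocallyTrivialAt (discreteSubgroups E) Γ := by
  obtain ⟨t, ht, ht0⟩ := (((tendsto_dilate_ofSubmodule_maxSubspace Γ).eventually
    (locallyTrivialAt_ofSubmodule (maxSubspace Γ)).eventually).and
      eventually_mem_nhdsWithin).exists
  let e := (LinearEquiv.smulOfNeZero ℝ E t ht0).symm.toContinuousLinearEquiv.toContinuousAddEquiv
  have hdilate : congr e Γ = dilate t Γ := rfl
  rw [← preimage_congr_discreteSubgroups e]
  exact .preimage _ (hdilate ▸ ht)

end Global

end ChabautySpace

theorem theoremC_general {E : Type*} [NormedAddCommGroup E] [NormedSpace ℝ E]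
    [FiniteDimensional ℝ E] : SimplyConnectedSpace (ChabautySpace E) :=
  simplyConnectedSpace_of_locallyTrivialAt ChabautySpace.isPathConnected_discreteSubgroups
    ChabautySpace.homotopicallyTrivialIn_discreteSubgroups
    ChabautySpace.accessibleFrom_discreteSubgroups
    ChabautySpace.locallyTrivialAt_discreteSubgroups

theorem theoremC (n : ℕ) : SimplyConnectedSpace (ChabautySpace (EuclideanSpace ℝ (Fin n))) :=
  theoremC_general
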